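/- **Definitions.** A *progressive graph* is a finite acyclic directed graph $G$ (parallel edges allowed) in which every source and every sink has degree one. A vertex of degree one is a *boundary* vertex, any other vertex is *internal*; an edge that starts at (resp. ends at) a boundary vertex is an *input* (resp. *output*) edge. For edges write $e_1\to e_2$ if there is a directed path with first edge $e_1$ and last edge $e_2\ne e_1$. A *planar order* on $G$ is a (strict) linear order $\prec$ on the edge set $E(G)$ such that $(P_1)$ $e_1\to e_2$ implies $e_1\prec e_2$, and $(P_2)$ if $e_1\prec e_2\prec e_3$ and $e_1\to e_3$, then $e_1\to e_2$ or $e_2\to e_3$. An *upward BP-embedding* of $G$ is a planar embedding of $G$ into a plane box $[l,r]\times[b,t]$ with all sources on the upper side, all sinks on the lower side, and every edge strictly decreasing in the vertical direction. $G$ is *elementary* if each connected subgraph has at most one internal vertex. An *elementary cut* of an upward BP-embedding $\phi$ is a sequence of heights $t=y_0>y_1>\dots>y_{n+1}=b$ such that no vertex lies at a height $y_k$ with $1\le k\le n$ and such that for $0\le k\le n$ the graph $\Gamma_k$ cut out of $\phi$ by the strip between the heights $y_{k+1}$ and $y_k$ (the *$k$-th layer*; the points where edges meet the two bounding lines are its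 boundary vertices) is elementary. A piece of an edge $e$ of $G$ in a layer is denoted by $e$ again. The *layer order* $\prec_k$ on $E(\Gamma_k)$ orders the edges from left to right and from up to down: $e\prec_k e'$ iff $e\to e'$ in $\Gamma_k$, or neither $e\to e'$ nor $e'\to e$ in $\Gamma_k$ and $e$ is to the left of $e'$. Here two edges that both meet the upper line (or both meet the lower line) of the layer are compared on it, and an edge that does not meet the upper line is compared with one that does by replacing the former by an edge of $\Gamma_k$ that meets the upper line and leads to it. If $\prec$ is a linear order on the edges of an upper graph with output edges $o_1\prec\dots\prec o_m$ and $\prec'$ is one on the edges of a lower graph with input edges $i_1\prec'\dots\prec' i_m$, their *composition* $\prec'\circ\prec$, on the union of the two edge sets with $o_j$ and $i_j$ identified to one edge $s_j$, is the linear order in which the edges come in the sequence $$Q_1,\ s_1,\ P_1,\ Q_2,\ s_2,\ P_2,\ \dots,\ Q_m,\ s_m,\ P_m,$$ where $Q_j$ is the open interval $(o_{j-1},o_j)$ of $\prec$ (for $j=1$, everything before $o_1$) and $P_j$ is the open interval $(i_j,i_{j+1})$ of $\prec'$ (for $j=m$, everything after $i_m$). **Proposition.** Let $\phi$ be an upward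 BP-embedding of a progressive graph $G$. Then: 1. $\phi$ has an elementary cut. 2. For every elementary cut of $\phi$, every layer $\Gamma_k$ is a progressive graph and its layer order $\prec_k$ is a planar order on $\Gamma_k$; and for $0\le k<n$ the edges common to the first $k+1$ layers and $\Gamma_{k+1}$ are exactly the output edges of the part of $\phi$ between the heights $y_{k+1}$ and $y_0$, are exactly the input edges of $\Gamma_{k+1}$, and are ordered in the same way by $\prec_k\circ\dots\circ\prec_0$ and by $\prec_{k+1}$, so that the two orders can be composed. 3. There is exactly one planar order $\prec_\phi$ on $G$ such that for every elementary cut of $\phi$ the composition $\prec_n\circ\dots\circ\prec_0$ of its layer orders is an order on all of $E(G)$ and equals $\prec_\phi$. In particular this composition is a planar order on $G$ that does not depend on the cut. -/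

import Mathlib

/-- A directed multigraph with vertex type `V` and edge type `E`: every edge `e` goes from
`src e` to `tgt e`. -/
structure DirectedMultigraph (V E : Type*) where
  src : E → V
  tgt : E → V

namespace DirectedMultigraph

/-- `e₁ → e₂`: there is a directed path whose first edge is `e₁` and whose last edge is `e₂`, and
which has at least two edges (so that this is a strict order on an acyclic graph). -/
def EdgePath {V E : Type*} (G : DirectedMultigraph V E) : E → E → Prop :=
  Relation.TransGen fun e f => G.tgt e = G.src f

/-- There is no directed cycle. -/
def IsAcyclic {V E : Type*} (G : DirectedMultigraph V E) : Prop :=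
  ∀ e, ¬ G.EdgePath e e

/-- The number of incident edges of `v` (only used where it is finite). -/
noncomputable def degree {V E : Type*} (G : DirectedMultigraph V E) (v : V) : ℕ :=
  Nat.card {e // G.src e = v} + Nat.card {e // G.tgt e = v}

/-- No edge ends at `v`. -/
def IsSource {V E : Type*} (G : DirectedMultigraph V E) (v : V) : Prop :=
  ∀ e, G.tgt e ≠ v

/-- No edge starts at `v`. -/
def IsSink {V E : Type*} (G : DirectedMultigraph V E) (v : V) : Prop :=
  ∀ e, G.src e ≠ v

/-- An acyclic directed graph all of whose sources and sinks have degree one. -/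
structure IsProgressive {V E : Type*} (G : DirectedMultigraph V E) : Prop where
  acyclic : G.IsAcyclic
  degree_source : ∀ v, G.IsSource v → G.degree v = 1
  degree_sink : ∀ v, G.IsSink v → G.degree v = 1

/-- A boundary vertex is a vertex of degree one. -/
def IsBoundary {V E : Type*} (G : DirectedMultigraph V E) (v : V) : Prop :=
  G.degree v = 1

/-- An internal vertex is a vertex that is not a boundary vertex. -/
def IsInternal {V E : Type*} (G : DirectedMultigraph V E) (v : V) : Prop :=
  ¬ G.IsBoundary v

/-- An input edge starts at a boundary vertex. -/
def IsInput {V E : Type*} (G : DirectedMultigraph V E) (e : E) : Prop :=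
  G.IsBoundary (G.src e)

/-- An output edge ends at a boundary vertex. -/
def IsOutput {V E : Type*} (G : DirectedMultigraph V E) (e : E) : Prop :=
  G.IsBoundary (G.tgt e)

/-- `u` and `v` lie in the same connected component of the underlying undirected graph. -/
def Connected {V E : Type*} (G : DirectedMultigraph V E) : V → V → Prop :=
  Relation.EqvGen fun u v => ∃ e, G.src e = u ∧ G.tgt e = v

/-- A connected subgraph contains at most one internal vertex. -/
def IsElementary {V E : Type*} (G : DirectedMultigraph V E) : Prop :=
  ∀ u v, G.IsInternal u → G.IsInternal v → G.Connected u v → u = v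

/-- A planar order: a (strict) linear order on the edges with the properties `(P₁)`, `(P₂)`. -/
structure IsPlanarOrder {V E : Type*} (G : DirectedMultigraph V E) (r : E → E → Prop) : Prop where
  irrefl : ∀ e, ¬ r e e
  trans : ∀ e₁ e₂ e₃, r e₁ e₂ → r e₂ e₃ → r e₁ e₃
  total : ∀ e₁ e₂, e₁ ≠ e₂ → r e₁ e₂ ∨ r e₂ e₁
  of_path : ∀ e₁ e₂, G.EdgePath e₁ e₂ → r e₁ e₂
  between : ∀ e₁ e₂ e₃, r e₁ e₂ → r e₂ e₃ → G.EdgePath e₁ e₃ →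
    G.EdgePath e₁ e₂ ∨ G.EdgePath e₂ e₃

end DirectedMultigraph

/-- A boxed planar embedding: vertices go to distinct points of a plane box, every edge goes to a
simple arc in the box that joins the images of its ends, an interior point of an arc is neither
the image of a vertex nor a point of another arc, all sources lie on the upper and all sinks on the
lower horizontal side of the box. -/
structure BPEmbedding {V E : Type*} (G : DirectedMultigraph V E) where
  left : ℝ
  right : ℝ
  bottom : ℝ
  top : ℝ
  left_lt_right : left < right
  bottom_lt_top : bottom < top
  pos : V → ℝ × ℝ
  arc : ∀ e : E, Path (pos (G.src e)) (pos (G.tgt e))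
  pos_mem : ∀ v, pos v ∈ Set.Icc left right ×ˢ Set.Icc bottom top
  arc_mem : ∀ e t, arc e t ∈ Set.Icc left right ×ˢ Set.Icc bottom top
  pos_injective : Function.Injective pos
  arc_injective : ∀ e, Function.Injective (arc e)
  arc_ne_pos : ∀ e t v, 0 < t → t < 1 → arc e t ≠ pos v
  arc_ne_arc : ∀ e e' t t', e ≠ e' → 0 < t → t < 1 → arc e t ≠ arc e' t'
  source_top : ∀ v, G.IsSource v → (pos v).2 = top
  sink_bottom : ∀ v, G.IsSink v → (pos v).2 = bottom

/-- A set of edges together with a relation on it. -/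
@[ext]
structure OrderedEdges (E : Type*) where
  carrier : Set E
  lt : E → E → Prop

namespace OrderedEdges

/-- The composition `≺₂ ∘ ≺₁` of an upper ordered edge set `A = (E₁, ≺₁)` and a lower one
`B = (E₂, ≺₂)`, where every output edge `oₖ` of `A` is already identified with the `k`-th input
edge `iₖ` of `B`, so that the common edges are the seam `{s₁ ≺ ⋯ ≺ sₙ}`. It is the shuffle order
`Q₁ ◁ {s₁} ◁ P₁ ◁ ⋯ ◁ Qₖ ◁ {sₖ} ◁ Pₖ ◁ ⋯ ◁ Qₙ ◁ {sₙ} ◁ Pₙ` where `Qₖ` is the interval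
`(oₖ₋₁, oₖ)` of `A` and `Pₖ` is the interval `(iₖ, iₖ₊₁)` of `B`: it extends both orders; an edge of
`Qₖ` precedes an edge of `Pₗ` iff `k ≤ l`, i.e. iff some seam edge comes after the first in `A` and
before the second in `B`; in the opposite case the edge of `Pₗ` precedes the edge of `Qₖ`. -/
def comp {E : Type*} (B A : OrderedEdges E) : OrderedEdges E where
  carrier := A.carrier ∪ B.carrier
  lt e e' :=
    (e ∈ A.carrier ∧ e' ∈ A.carrier ∧ A.lt e e') ∨
    (e ∈ B.carrier ∧ e' ∈ B.carrier ∧ B.lt e e') ∨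
    (e ∈ A.carrier \ B.carrier ∧ e' ∈ B.carrier \ A.carrier ∧
      ∃ s ∈ A.carrier ∩ B.carrier, A.lt e s ∧ B.lt s e') ∨
    (e ∈ B.carrier \ A.carrier ∧ e' ∈ A.carrier \ B.carrier ∧
      ¬ ∃ s ∈ A.carrier ∩ B.carrier, A.lt e' s ∧ B.lt s e)

end OrderedEdges

namespace BPEmbedding

/-- Every edge is strictly monotone in the vertical direction (downwards, since the sources are on
the upper side of the box). -/
def IsUpward {V E : Type*} {G : DirectedMultigraph V E} (φ : BPEmbedding G) : Prop :=
  ∀ e, StrictAnti fun t => (φ.arc e t).2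

/-- The vertical coordinate of a vertex. -/
def height {V E : Type*} {G : DirectedMultigraph V E} (φ : BPEmbedding G) (v : V) : ℝ :=
  (φ.pos v).2

/-- The edges of `φ` that pass through the open horizontal strip between the heights `b < a`.
As edges are monotone, the part of such an edge inside the strip is a single arc, which is written
as the edge itself. -/
def StripEdges {V E : Type*} {G : DirectedMultigraph V E} (φ : BPEmbedding G) (a b : ℝ) : Set E :=
  {e | φ.height (G.tgt e) < a ∧ b < φ.height (G.src e)}

/-- The vertices of the part of `φ` in the strip between the heights `b < a`: the vertices of `G`
strictly between the two lines, the points of edges on the upper line and the points of edges on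
the lower line. -/
abbrev StripVertex {V E : Type*} {G : DirectedMultigraph V E} (φ : BPEmbedding G) (a b : ℝ) :
    Type _ :=
  {v : V // b < φ.height v ∧ φ.height v < a} ⊕
    ({e : φ.StripEdges a b // a ≤ φ.height (G.src e)} ⊕
      {e : φ.StripEdges a b // φ.height (G.tgt e) ≤ b})

open Classical in
/-- The graph cut out of `φ` by the strip between the heights `b < a`. -/
noncomputable def stripGraph {V E : Type*} {G : DirectedMultigraph V E} (φ : BPEmbedding G)
    (a b : ℝ) : DirectedMultigraph (φ.StripVertex a b) (φ.StripEdges a b) where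
  src e :=
    if h : φ.height (G.src e) < a then Sum.inl ⟨G.src e, e.2.2, h⟩
    else Sum.inr (Sum.inl ⟨e, not_lt.1 h⟩)
  tgt e :=
    if h : b < φ.height (G.tgt e) then Sum.inl ⟨G.tgt e, h, e.2.1⟩
    else Sum.inr (Sum.inr ⟨e, not_lt.1 h⟩)

/-- On the horizontal line at height `h`, the edge `e` is to the left of the edge `e'`. -/
def LeftAt {V E : Type*} {G : DirectedMultigraph V E} (φ : BPEmbedding G) (h : ℝ) (e e' : E) :
    Prop :=
  ∃ x x' : ℝ, (x, h) ∈ Set.range (φ.arc e) ∧ (x', h) ∈ Set.range (φ.arc e') ∧ x < x'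

/-- In an elementary layer `e` is to the left of `e'` (for edges that are not joined by a directed
path): if both edges reach the upper line, or both reach the lower line, they are compared there;
if only one of them reaches the upper line, it is compared there with the edges of the layer that
lead to the other one. -/
def LayerLeft {V E : Type*} {G : DirectedMultigraph V E} (φ : BPEmbedding G) (a b : ℝ)
    (e e' : φ.StripEdges a b) : Prop :=
  ((φ.stripGraph a b).IsInput e ∧ (φ.stripGraph a b).IsInput e' ∧ φ.LeftAt a e e') ∨
  ((φ.stripGraph a b).IsOutput e ∧ (φ.stripGraph a b).IsOutput e' ∧ φ.LeftAt b e e') ∨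
  ((φ.stripGraph a b).IsInput e ∧ ∃ f', (φ.stripGraph a b).IsInput f' ∧
    (φ.stripGraph a b).EdgePath f' e' ∧ φ.LeftAt a e f') ∨
  ((φ.stripGraph a b).IsInput e' ∧ ∃ f, (φ.stripGraph a b).IsInput f ∧
    (φ.stripGraph a b).EdgePath f e ∧ φ.LeftAt a f e')

/-- The order of the edges of an elementary layer, from left to right and from up to down: an edge
precedes the edges below it on a directed path of the layer, and edges that are not joined by a
directed path of the layer are ordered from left to right. -/
def LayerLT {V E : Type*} {G : DirectedMultigraph V E} (φ : BPEmbedding G) (a b : ℝ)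
    (e e' : φ.StripEdges a b) : Prop :=
  (φ.stripGraph a b).EdgePath e e' ∨
  (¬ (φ.stripGraph a b).EdgePath e e' ∧ ¬ (φ.stripGraph a b).EdgePath e' e ∧ φ.LayerLeft a b e e')

/-- The ordered edge set of the layer between the heights `b < a`. -/
def layer {V E : Type*} {G : DirectedMultigraph V E} (φ : BPEmbedding G) (a b : ℝ) :
    OrderedEdges E where
  carrier := φ.StripEdges a b
  lt e e' := ∃ (h : e ∈ φ.StripEdges a b) (h' : e' ∈ φ.StripEdges a b), φ.LayerLT a b ⟨e, h⟩ ⟨e', h'⟩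

/-- The heights `y 0 > y 1 > ⋯ > y (n + 1)` cut `φ` into the `n + 1` elementary layers between
`y k` and `y (k + 1)`, `0 ≤ k ≤ n`: the first and last one are those of the horizontal sides of the
box, the others avoid all vertices, and every layer is elementary. The values `y i` with
`i > n + 1` are irrelevant. -/
structure IsElementaryCut {V E : Type*} {G : DirectedMultigraph V E} (φ : BPEmbedding G)
    (n : ℕ) (y : ℕ → ℝ) : Prop where
  first : y 0 = φ.top
  last : y (n + 1) = φ.bottom
  decreasing : ∀ k ≤ n, y (k + 1) < y k
  avoids : ∀ k < n, ∀ v, φ.height v ≠ y (k + 1)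
  elementary : ∀ k ≤ n, (φ.stripGraph (y k) (y (k + 1))).IsElementary

/-- The composition `≺ₖ ∘ ⋯ ∘ ≺₀` of the orders of the layers `0, …, k` of a cut. -/
def composite {V E : Type*} {G : DirectedMultigraph V E} (φ : BPEmbedding G) (y : ℕ → ℝ) :
    ℕ → OrderedEdges E
  | 0 => φ.layer (y 0) (y 1)
  | k + 1 => (φ.layer (y (k + 1)) (y (k + 2))).comp (composite φ y k)

/-- The composition of the layers `0, …, k` can be composed with layer `k + 1`: the edges that they
share are the output edges of the part of `φ` above `y (k + 1)`, they are the input edges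
of layer `k + 1`, and both orders list them in the same way. -/
structure SeamMatches {V E : Type*} {G : DirectedMultigraph V E} (φ : BPEmbedding G)
    (y : ℕ → ℝ) (k : ℕ) : Prop where
  outputs : (φ.composite y k).carrier ∩ (φ.layer (y (k + 1)) (y (k + 2))).carrier =
    Subtype.val '' {e | (φ.stripGraph (y 0) (y (k + 1))).IsOutput e}
  inputs : (φ.composite y k).carrier ∩ (φ.layer (y (k + 1)) (y (k + 2))).carrier =
    Subtype.val '' {e | (φ.stripGraph (y (k + 1)) (y (k + 2))).IsInput e}
  agree : ∀ e ∈ (φ.composite y k).carrier ∩ (φ.layer (y (k + 1)) (y (k + 2))).carrier,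
    ∀ e' ∈ (φ.composite y k).carrier ∩ (φ.layer (y (k + 1)) (y (k + 2))).carrier,
      (φ.composite y k).lt e e' ↔ (φ.layer (y (k + 1)) (y (k + 2))).lt e e'

end BPEmbedding

/-! The order of the proposition can be described without any cut: `EdgeLT` says that `e → e'`, or
that the two edges are incomparable and `e` lies to the left of `e'`. Every layer order is a
restriction of this one order, and composition turns restrictions into restrictions, so the
composition cannot depend on the cut.

To make "left" meaningful for edges that share no height, each edge is extended to a thread: a
directed path from the upper to the lower side of the box, which by upwardness is the graph of a
continuous function of the height. If threads through `e` and `e'` met at a height between the lower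
of the two ends and the higher of the two starts, one could switch threads there and get a path
joining `e` and `e'` (`IsThread.pathLE_of_eq`). For incomparable edges the intermediate value
theorem therefore fixes the order of the threads on that interval, `Hull`. Three hulls have a common
height, which makes "left" transitive and incompatible with paths; this yields a planar order
(`isPlanarOrder_edgeLT`).

In an elementary layer every edge meets the upper or the lower line, so the comparisons on these
lines decide all incomparable pairs, and they agree with the threads (`IsSlab.layerLT_iff`). By
(P₂), whenever an edge above a seam precedes one below it, some seam edge lies between them
(`exists_seam_between`), which is what the shuffle composition requires. Induction on the layers
identifies each composite with a restriction of `EdgeLT`. A cut exists because finitely many heights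
can be separated, and its existence also forces uniqueness. -/

namespace DirectedMultigraph

/-! ### Directed paths and incomparability. -/

/-- `e = f` or `e → f`. -/
def PathLE {V E : Type*} (G : DirectedMultigraph V E) : E → E → Prop :=
  Relation.ReflTransGen fun e f => G.tgt e = G.src f

/-- The edges `e` and `f` are distinct and not joined by a directed path. -/
def Incomparable {V E : Type*} (G : DirectedMultigraph V E) (e f : E) : Prop :=
  ¬ G.PathLE e f ∧ ¬ G.PathLE f e

/-- `v` is an end of the edge `e`. -/
def IsEnd {V E : Type*} (G : DirectedMultigraph V E) (e : E) (v : V) : Prop :=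
  G.src e = v ∨ G.tgt e = v

variable {V E : Type*} {G : DirectedMultigraph V E} {e f g : E}

theorem PathLE.refl (e : E) : G.PathLE e e := Relation.ReflTransGen.refl

theorem PathLE.trans (h : G.PathLE e f) (h' : G.PathLE f g) : G.PathLE e g :=
  Relation.ReflTransGen.trans h h'

theorem PathLE.single (h : G.tgt e = G.src f) : G.PathLE e f := Relation.ReflTransGen.single h

theorem EdgePath.pathLE (h : G.EdgePath e f) : G.PathLE e f := Relation.TransGen.to_reflTransGen h

theorem pathLE_iff : G.PathLE e f ↔ e = f ∨ G.EdgePath e f := by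
  rw [PathLE, Relation.reflTransGen_iff_eq_or_transGen, eq_comm, EdgePath]

theorem edgePath_iff_head : G.EdgePath e f ↔ ∃ g, G.tgt e = G.src g ∧ G.PathLE g f :=
  Relation.TransGen.head'_iff

theorem edgePath_iff_tail : G.EdgePath e f ↔ ∃ g, G.PathLE e g ∧ G.tgt g = G.src f :=
  Relation.TransGen.tail'_iff

theorem EdgePath.trans (h : G.EdgePath e f) (h' : G.EdgePath f g) : G.EdgePath e g :=
  Relation.TransGen.trans h h'

theorem incomparable_iff :
    G.Incomparable e f ↔ e ≠ f ∧ ¬ G.EdgePath e f ∧ ¬ G.EdgePath f e := by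
  simp only [Incomparable, pathLE_iff, eq_comm (a := f) (b := e)]
  tauto

theorem Incomparable.symm (h : G.Incomparable e f) : G.Incomparable f e := ⟨h.2, h.1⟩

end DirectedMultigraph

namespace BPEmbedding

open DirectedMultigraph Set

/-! ### Edges as graphs of functions of the height. -/

section Heights

variable {V E : Type*} {G : DirectedMultigraph V E} {φ : BPEmbedding G} {e e' f : E}

theorem IsUpward.height_tgt_lt (hφ : φ.IsUpward) (e : E) :
    φ.height (G.tgt e) < φ.height (G.src e) := by
  simpa [height] using hφ e (show (0 : unitInterval) < 1 from zero_lt_one)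

theorem height_le_top (φ : BPEmbedding G) (v : V) : φ.height v ≤ φ.top := (φ.pos_mem v).2.2

theorem bottom_le_height (φ : BPEmbedding G) (v : V) : φ.bottom ≤ φ.height v := (φ.pos_mem v).2.1

theorem IsUpward.height_src_le_height_tgt (hφ : φ.IsUpward) (h : G.EdgePath e f) :
    φ.height (G.src f) ≤ φ.height (G.tgt e) := by
  induction h with
  | single h => rw [h]
  | tail _ h ih => exact (h ▸ (hφ.height_tgt_lt _).le).trans ih

theorem IsUpward.height_src_le_height_src (hφ : φ.IsUpward) (h : G.PathLE e f) :
    φ.height (G.src f) ≤ φ.height (G.src e) := by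
  rcases pathLE_iff.1 h with rfl | h
  · exact le_rfl
  · exact (hφ.height_src_le_height_tgt h).trans (hφ.height_tgt_lt e).le

theorem IsUpward.isAcyclic (hφ : φ.IsUpward) : G.IsAcyclic := fun e h =>
  (hφ.height_src_le_height_tgt h).not_gt (hφ.height_tgt_lt e)

/-- The heights that an edge passes through. -/
def Span (φ : BPEmbedding G) (e : E) : Set ℝ := Icc (φ.height (G.tgt e)) (φ.height (G.src e))

theorem height_arc_mem_span (hφ : φ.IsUpward) (e : E) (t : unitInterval) :
    (φ.arc e t).2 ∈ φ.Span e := by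
  have h0 := (hφ e).antitone (unitInterval.nonneg' (t := t))
  have h1 := (hφ e).antitone (unitInterval.le_one' (t := t))
  simp only [Path.source, Path.target] at h0 h1
  exact ⟨h1, h0⟩

/-- The height along an arc is a closed embedding of the unit interval into the line, so Tietze's
theorem extends the horizontal coordinate. Its values outside `Span` are arbitrary. -/
theorem exists_xCoord (hφ : φ.IsUpward) (e : E) :
    ∃ x : C(ℝ, ℝ), ∀ t, x (φ.arc e t).2 = (φ.arc e t).1 := by
  have hc : Continuous fun t => (φ.arc e t).2 := by fun_prop
  obtain ⟨x, hx⟩ := ContinuousMap.exists_extension (hc.isClosedEmbedding (hφ e).injective)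
    (⟨fun t => (φ.arc e t).1, by fun_prop⟩ : C(unitInterval, ℝ))
  exact ⟨x, fun t => DFunLike.congr_fun hx t⟩

/-- The horizontal coordinate of an edge as a function of the height. -/
noncomputable def xCoord (hφ : φ.IsUpward) (e : E) : C(ℝ, ℝ) := (exists_xCoord hφ e).choose

theorem xCoord_arc (hφ : φ.IsUpward) (e : E) (t : unitInterval) :
    xCoord hφ e (φ.arc e t).2 = (φ.arc e t).1 := (exists_xCoord hφ e).choose_spec t

theorem exists_arc_eq (hφ : φ.IsUpward) {h : ℝ} (hh : h ∈ φ.Span e) :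
    ∃ t, φ.arc e t = (xCoord hφ e h, h) := by
  have hc : Continuous fun t => (φ.arc e t).2 := by fun_prop
  obtain ⟨t, ht⟩ := mem_range_of_exists_le_of_exists_ge hc
    (⟨1, (congrArg Prod.snd (φ.arc e).target).trans_le hh.1⟩ : ∃ t, (φ.arc e t).2 ≤ h)
    ⟨0, hh.2.trans_eq (congrArg Prod.snd (φ.arc e).source).symm⟩
  refine ⟨t, Prod.ext ?_ ht⟩
  rw [← xCoord_arc hφ]
  exact congrArg _ ht

theorem leftAt_iff (hφ : φ.IsUpward) {h : ℝ} :
    φ.LeftAt h e e' ↔ h ∈ φ.Span e ∧ h ∈ φ.Span e' ∧ xCoord hφ e h < xCoord hφ e' h := by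
  constructor
  · rintro ⟨x, x', ⟨t, ht⟩, ⟨t', ht'⟩, hx⟩
    have h1 := height_arc_mem_span hφ e t
    have h2 := height_arc_mem_span hφ e' t'
    have h3 := xCoord_arc hφ e t
    have h4 := xCoord_arc hφ e' t'
    rw [ht] at h1 h3
    rw [ht'] at h2 h4
    exact ⟨h1, h2, by simpa [h3, h4] using hx⟩
  · rintro ⟨h1, h2, hx⟩
    exact ⟨_, _, exists_arc_eq hφ h1, exists_arc_eq hφ h2, hx⟩

theorem xCoord_height_src (hφ : φ.IsUpward) (e : E) :
    xCoord hφ e (φ.height (G.src e)) = (φ.pos (G.src e)).1 := by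
  simpa [height] using xCoord_arc hφ e 0

theorem xCoord_height_tgt (hφ : φ.IsUpward) (e : E) :
    xCoord hφ e (φ.height (G.tgt e)) = (φ.pos (G.tgt e)).1 := by
  simpa [height] using xCoord_arc hφ e 1

theorem isEnd_of_arc_eq (h : e ≠ e') {t t' : unitInterval} (heq : φ.arc e t = φ.arc e' t') :
    ∃ v, G.IsEnd e v ∧ φ.pos v = φ.arc e t := by
  rcases (unitInterval.nonneg' (t := t)).eq_or_lt with rfl | h0
  · exact ⟨_, Or.inl rfl, (φ.arc e).source.symm⟩
  rcases (unitInterval.le_one' (t := t)).eq_or_lt with rfl | h1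
  · exact ⟨_, Or.inr rfl, (φ.arc e).target.symm⟩
  exact absurd heq (φ.arc_ne_arc e e' t t' h h0 h1)

/-- Distinct edges meet only in common ends. -/
theorem exists_common_end (hφ : φ.IsUpward) (h : e ≠ e') {y : ℝ} (hy : y ∈ φ.Span e)
    (hy' : y ∈ φ.Span e') (heq : xCoord hφ e y = xCoord hφ e' y) :
    ∃ v, φ.height v = y ∧ G.IsEnd e v ∧ G.IsEnd e' v := by
  obtain ⟨t, ht⟩ := exists_arc_eq hφ hy
  obtain ⟨t', ht'⟩ := exists_arc_eq hφ hy'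
  have htt : φ.arc e t = φ.arc e' t' := by rw [ht, ht', heq]
  obtain ⟨v, hv, hpos⟩ := isEnd_of_arc_eq h htt
  obtain ⟨v', hv', hpos'⟩ := isEnd_of_arc_eq h.symm htt.symm
  obtain rfl : v = v' := φ.pos_injective (by rw [hpos, hpos', htt])
  exact ⟨v, by rw [height, hpos, ht], hv, hv'⟩

end Heights

/-! ### Threads and the left-right order of incomparable edges. -/

section Threads

variable {V E : Type*} {G : DirectedMultigraph V E} {φ : BPEmbedding G} {hφ : φ.IsUpward}
  {e e' f g : E} {C D : Set E} {p q : ℝ → ℝ}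

/-- A chain `C` of edges that passes through all heights between the lower side of the box and `a`,
together with the continuous function `p` whose graph it is. -/
structure IsThread (hφ : φ.IsUpward) (a : ℝ) (C : Set E) (p : ℝ → ℝ) : Prop where
  continuous : Continuous p
  chain : ∀ f ∈ C, ∀ g ∈ C, G.PathLE f g ∨ G.PathLE g f
  cover : ∀ h, φ.bottom ≤ h → h ≤ a → ∃ f ∈ C, h ∈ φ.Span f
  agree : ∀ f ∈ C, ∀ h ∈ φ.Span f, p h = xCoord hφ f h

/-- A thread that starts with the edge `e`. -/
structure IsThreadFrom (hφ : φ.IsUpward) (e : E) (C : Set E) (p : ℝ → ℝ) : Prop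
    extends IsThread hφ (φ.height (G.src e)) C p where
  mem : e ∈ C
  le : ∀ f ∈ C, G.PathLE e f

theorem isThreadFrom_singleton (h : G.IsSink (G.tgt e)) :
    IsThreadFrom hφ e {e} (xCoord hφ e) where
  continuous := (xCoord hφ e).continuous
  chain := by rintro f rfl g rfl; exact Or.inl (.refl _)
  cover y h0 h1 := ⟨e, rfl, (φ.sink_bottom _ h).le.trans h0, h1⟩
  agree := by rintro f rfl y _; rfl
  mem := rfl
  le := by rintro f rfl; exact .refl _

/-- The two pieces glue continuously because both pass through the position of the common vertex. -/
theorem IsThreadFrom.cons (h : IsThreadFrom hφ e C p) (hg : G.tgt g = G.src e) :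
    IsThreadFrom hφ g (insert g C)
      (fun y => if y ≤ φ.height (G.tgt g) then p y else xCoord hφ g y) where
  continuous := by
    refine Continuous.if_le h.continuous (xCoord hφ g).continuous continuous_id continuous_const ?_
    rintro y rfl
    rw [xCoord_height_tgt, hg, h.agree e h.mem _ ⟨(hφ.height_tgt_lt e).le, le_rfl⟩,
      xCoord_height_src]
  chain := by
    rintro f (rfl | hf) f' (rfl | hf')
    · exact Or.inl (.refl _)
    · exact Or.inl ((PathLE.single hg).trans (h.le _ hf'))
    · exact Or.inr ((PathLE.single hg).trans (h.le _ hf))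
    · exact h.chain f hf f' hf'
  cover y h0 h1 := by
    rcases le_total y (φ.height (G.tgt g)) with hy | hy
    · obtain ⟨f, hf, hyf⟩ := h.cover y h0 (hg ▸ hy)
      exact ⟨f, Or.inr hf, hyf⟩
    · exact ⟨g, Or.inl rfl, hy, h1⟩
  agree := by
    rintro f (rfl | hf) y hy
    · split_ifs with hle
      · obtain rfl := le_antisymm hle hy.1
        rw [xCoord_height_tgt, hg, h.agree e h.mem _ ⟨(hφ.height_tgt_lt e).le, le_rfl⟩,
          xCoord_height_src]
      · rfl
    · rw [if_pos, h.agree f hf y hy]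
      rw [hg]
      exact hy.2.trans (hφ.height_src_le_height_src (h.le f hf))
  mem := Or.inl rfl
  le := by
    rintro f (rfl | hf)
    · exact .refl _
    · exact (PathLE.single hg).trans (h.le _ hf)

theorem wellFounded_height_lt [Finite E] (φ : BPEmbedding G) :
    WellFounded fun f e : E => φ.height (G.src f) < φ.height (G.src e) :=
  @Finite.wellFounded_of_trans_of_irrefl _ _ _ ⟨fun _ _ _ h h' => h.trans h'⟩
    ⟨fun _ h => lt_irrefl _ h⟩

theorem wellFounded_height_gt [Finite E] (φ : BPEmbedding G) :
    WellFounded fun f e : E => φ.height (G.src e) < φ.height (G.src f) :=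
  @Finite.wellFounded_of_trans_of_irrefl _ _ _ ⟨fun _ _ _ h h' => h'.trans h⟩
    ⟨fun _ h => lt_irrefl _ h⟩

theorem exists_isThreadFrom [Finite E] (hφ : φ.IsUpward) (e : E) :
    ∃ C p, IsThreadFrom hφ e C p := by
  induction e using (wellFounded_height_lt φ).induction with
  | _ e ih =>
    by_cases h : G.IsSink (G.tgt e)
    · exact ⟨_, _, isThreadFrom_singleton h⟩
    · obtain ⟨f, hf⟩ := not_forall_not.1 h
      obtain ⟨C, p, hC⟩ := ih f (hf ▸ hφ.height_tgt_lt e)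
      exact ⟨_, _, hC.cons hf.symm⟩

theorem exists_isThreadFrom_mem [Finite E] (hφ : φ.IsUpward) (h : G.PathLE e f) :
    ∃ C p, IsThreadFrom hφ e C p ∧ f ∈ C := by
  induction h using Relation.ReflTransGen.head_induction_on with
  | refl =>
    obtain ⟨C, p, hC⟩ := exists_isThreadFrom hφ f
    exact ⟨C, p, hC, hC.mem⟩
  | head h _ ih =>
    obtain ⟨C, p, hC, hf⟩ := ih
    exact ⟨_, _, hC.cons h, Or.inr hf⟩

/-- Prepending edges can stop only at a source, and sources lie on the upper side of the box. -/
theorem IsThreadFrom.exists_extension [Finite E] (h : IsThreadFrom hφ e C p) :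
    ∃ D q, IsThread hφ φ.top D q ∧ C ⊆ D := by
  induction e using (wellFounded_height_gt φ).induction generalizing C p with
  | _ e ih =>
    by_cases hs : G.IsSource (G.src e)
    · exact ⟨C, p, φ.source_top _ hs ▸ h.toIsThread, subset_rfl⟩
    · obtain ⟨g, hg⟩ := not_forall_not.1 hs
      obtain ⟨D, q, hD, hCD⟩ := ih g (hg ▸ hφ.height_tgt_lt g) (h.cons hg)
      exact ⟨D, q, hD, (subset_insert _ _).trans hCD⟩

/-- Two edges on a directed path lie on a common thread. -/
theorem exists_isThread_pair [Finite E] (hφ : φ.IsUpward) (h : G.PathLE e f) :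
    ∃ C p, IsThread hφ φ.top C p ∧ e ∈ C ∧ f ∈ C := by
  obtain ⟨C, p, hC, hf⟩ := exists_isThreadFrom_mem hφ h
  obtain ⟨D, q, hD, hCD⟩ := hC.exists_extension
  exact ⟨D, q, hD, hCD hC.mem, hCD hf⟩

theorem exists_isThread [Finite E] (hφ : φ.IsUpward) (e : E) :
    ∃ C p, IsThread hφ φ.top C p ∧ e ∈ C := by
  obtain ⟨C, p, hC, he, -⟩ := exists_isThread_pair hφ (PathLE.refl (G := G) e)
  exact ⟨C, p, hC, he⟩

theorem exists_tgt_eq_of_isEnd {v : V} (h : G.PathLE e f) (hv : G.IsEnd f v)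
    (hlt : φ.height v < φ.height (G.src e)) : ∃ f', G.PathLE e f' ∧ G.tgt f' = v := by
  rcases hv with rfl | hv
  · rcases pathLE_iff.1 h with rfl | h
    · exact absurd hlt (lt_irrefl _)
    · exact edgePath_iff_tail.1 h
  · exact ⟨f, h, hv⟩

theorem exists_src_eq_of_isEnd {v : V} (h : G.PathLE f e) (hv : G.IsEnd f v)
    (hlt : φ.height (G.tgt e) < φ.height v) : ∃ f', G.src f' = v ∧ G.PathLE f' e := by
  rcases hv with hv | rfl
  · exact ⟨f, hv, h⟩
  · rcases pathLE_iff.1 h with rfl | h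
    · exact absurd hlt (lt_irrefl _)
    · obtain ⟨g, hg, h⟩ := edgePath_iff_head.1 h
      exact ⟨g, hg.symm, h⟩

/-- Threads meet in a common edge or a common vertex. Following the first thread from `e` down to
the meeting point and the second from there down to `e'` gives the path; the bounds on `y` ensure
that the point is reached after `e` starts and before `e'` ends. -/
theorem IsThread.pathLE_of_eq (hp : IsThread hφ φ.top C p) (hq : IsThread hφ φ.top D q)
    (he : e ∈ C) (he' : e' ∈ D) {y : ℝ} (hy : y < φ.height (G.src e))
    (hy' : φ.height (G.tgt e') < y) (heq : p y = q y) : G.PathLE e e' := by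
  have h0 : φ.bottom ≤ y := (φ.bottom_le_height _).trans hy'.le
  have h1 : y ≤ φ.top := hy.le.trans (φ.height_le_top _)
  obtain ⟨f, hf, hyf⟩ := hp.cover y h0 h1
  obtain ⟨g, hg, hyg⟩ := hq.cover y h0 h1
  have hef : G.PathLE e f := by
    rcases hp.chain e he f hf with h | h
    · exact h
    rcases pathLE_iff.1 h with rfl | h
    · exact .refl _
    · exact absurd (hφ.height_src_le_height_tgt h) (hyf.1.trans_lt hy).not_ge
  have hge : G.PathLE g e' := by
    rcases hq.chain g hg e' he' with h | h
    · exact h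
    rcases pathLE_iff.1 h with rfl | h
    · exact .refl _
    · exact absurd (hφ.height_src_le_height_tgt h) (hy'.trans_le hyg.2).not_ge
  by_cases hfg : f = g
  · exact hef.trans (hfg ▸ hge)
  rw [hp.agree f hf y hyf, hq.agree g hg y hyg] at heq
  obtain ⟨v, rfl, hvf, hvg⟩ := exists_common_end hφ hfg hyf hyg heq
  obtain ⟨f', hf', hfv⟩ := exists_tgt_eq_of_isEnd hef hvf hy
  obtain ⟨g', hgv, hg'⟩ := exists_src_eq_of_isEnd hge hvg hy'
  exact hf'.trans ((PathLE.single (hfv.trans hgv.symm)).trans hg')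

/-- The open interval spanned by the heights of two edges. -/
def Hull (φ : BPEmbedding G) (e e' : E) : Set ℝ :=
  Ioo (min (φ.height (G.tgt e)) (φ.height (G.tgt e')))
    (max (φ.height (G.src e)) (φ.height (G.src e')))

theorem hull_comm (φ : BPEmbedding G) (e e' : E) : φ.Hull e e' = φ.Hull e' e := by
  rw [Hull, Hull, min_comm, max_comm]

theorem exists_mem_hull_of_left (hφ : φ.IsUpward) (e e' : E) :
    ∃ y ∈ φ.Span e, y ∈ φ.Hull e e' := by
  obtain ⟨y, h0, h1⟩ := exists_between (hφ.height_tgt_lt e)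
  exact ⟨y, ⟨h0.le, h1.le⟩, min_lt_of_left_lt h0, lt_max_of_lt_left h1⟩

theorem exists_mem_hull_of_right (hφ : φ.IsUpward) (e e' : E) :
    ∃ y ∈ φ.Span e', y ∈ φ.Hull e e' := by
  rw [hull_comm]; exact exists_mem_hull_of_left hφ e' e

/-- One-dimensional Helly: any two of the three open intervals share an edge, hence the interior of
its span, so every lower bound is below every upper bound. -/
theorem exists_mem_hull_inter (hφ : φ.IsUpward) (e f g : E) :
    ∃ y, y ∈ φ.Hull e f ∧ y ∈ φ.Hull f g ∧ y ∈ φ.Hull e g := by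
  have h1 := hφ.height_tgt_lt e
  have h2 := hφ.height_tgt_lt f
  have h3 := hφ.height_tgt_lt g
  simp only [Hull, mem_Ioo]
  generalize φ.height (G.tgt e) = a at *
  generalize φ.height (G.tgt f) = b at *
  generalize φ.height (G.tgt g) = c at *
  generalize φ.height (G.src e) = a' at *
  generalize φ.height (G.src f) = b' at *
  generalize φ.height (G.src g) = c' at *
  have key : max (min a b) (max (min b c) (min a c)) <
      min (max a' b') (min (max b' c') (max a' c')) := by
    simp only [lt_min_iff, max_lt_iff, lt_max_iff, min_lt_iff]
    grind
  obtain ⟨y, hy, hy'⟩ := exists_between key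
  rw [max_lt_iff, max_lt_iff] at hy
  rw [lt_min_iff, lt_min_iff] at hy'
  exact ⟨y, ⟨hy.1, hy'.1⟩, ⟨hy.2.1, hy'.2.1⟩, hy.2.2, hy'.2.2⟩

/-- Threads through incomparable edges do not meet at the heights spanned by these edges. -/
theorem IsThread.ne_of_mem_hull (hp : IsThread hφ φ.top C p) (hq : IsThread hφ φ.top D q)
    (he : e ∈ C) (he' : e' ∈ D) (hinc : G.Incomparable e e') {y : ℝ} (hy : y ∈ φ.Hull e e') :
    p y ≠ q y := by
  intro heq
  have h1 := hφ.height_tgt_lt e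
  have h2 := hφ.height_tgt_lt e'
  obtain ⟨hy0, hy1⟩ := hy
  rw [min_lt_iff] at hy0
  rw [lt_max_iff] at hy1
  have : (y < φ.height (G.src e) ∧ φ.height (G.tgt e') < y) ∨
      (y < φ.height (G.src e') ∧ φ.height (G.tgt e) < y) := by
    rcases hy0 with hy0 | hy0 <;> rcases hy1 with hy1 | hy1
    · exact (lt_or_ge _ y).imp (⟨hy1, ·⟩) fun h => ⟨h.trans_lt h2, hy0⟩
    · exact Or.inr ⟨hy1, hy0⟩
    · exact Or.inl ⟨hy1, hy0⟩
    · exact (lt_or_ge _ y).symm.imp (fun h => ⟨h.trans_lt h1, hy0⟩) (⟨hy1, ·⟩)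
  rcases this with ⟨h, h'⟩ | ⟨h, h'⟩
  · exact hinc.1 (hp.pathLE_of_eq hq he he' h h' heq)
  · exact hinc.2 (hq.pathLE_of_eq hp he' he h h' heq.symm)

/-- The edge `e` is to the left of the edge `e'`, which is not joined to it by a directed path:
threads through these edges are in this order at the heights spanned by them. -/
def IsLeft (hφ : φ.IsUpward) (e e' : E) : Prop :=
  G.Incomparable e e' ∧ ∀ C p D q, IsThread hφ φ.top C p → IsThread hφ φ.top D q →
    e ∈ C → e' ∈ D → ∀ y ∈ φ.Hull e e', p y < q y

theorem IsThread.lt_of_lt (hp : IsThread hφ φ.top C p) (hq : IsThread hφ φ.top D q)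
    (he : e ∈ C) (he' : e' ∈ D) (hinc : G.Incomparable e e') {y z : ℝ} (hy : y ∈ φ.Hull e e')
    (hz : z ∈ φ.Hull e e') (hlt : p y < q y) : p z < q z := by
  by_contra! hle
  obtain ⟨x, hx, heq⟩ := isPreconnected_Ioo.intermediate_value₂ hy hz hp.continuous.continuousOn
    hq.continuous.continuousOn hlt.le hle
  exact hp.ne_of_mem_hull hq he he' hinc hx heq

/-- One pair of threads and one height suffice. All threads through an edge agree on its span, so
each thread can be exchanged at a height of its own edge, and the order is carried between heights
by `IsThread.lt_of_lt`. -/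
theorem isLeft_of_lt_of_mem_hull (hp : IsThread hφ φ.top C p) (hq : IsThread hφ φ.top D q)
    (he : e ∈ C) (he' : e' ∈ D) (hinc : G.Incomparable e e') {y : ℝ} (hy : y ∈ φ.Hull e e')
    (hlt : p y < q y) : IsLeft hφ e e' := by
  refine ⟨hinc, fun C' p' D' q' hp' hq' hC hD z hz => ?_⟩
  obtain ⟨x, hx, hxh⟩ := exists_mem_hull_of_left hφ e e'
  obtain ⟨x', hx', hxh'⟩ := exists_mem_hull_of_right hφ e e'
  have h1 := hp.lt_of_lt hq he he' hinc hy hxh hlt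
  rw [hp.agree e he x hx, ← hp'.agree e hC x hx] at h1
  have h2 := hp'.lt_of_lt hq hC he' hinc hxh hxh' h1
  rw [hq.agree e' he' x' hx', ← hq'.agree e' hD x' hx'] at h2
  exact hp'.lt_of_lt hq' hC hD hinc hxh' hz h2

/-- The height `y` may be an endpoint of the hull, as for edges that start on the upper side of the
box. The strict inequality is an open condition, so it persists at a nearby height inside the hull.
-/
theorem isLeft_of_lt (hp : IsThread hφ φ.top C p) (hq : IsThread hφ φ.top D q)
    (he : e ∈ C) (he' : e' ∈ D) (hinc : G.Incomparable e e') {y : ℝ}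
    (hy : y ∈ φ.Span e ∪ φ.Span e') (hlt : p y < q y) : IsLeft hφ e e' := by
  have hy' : y ∈ closure (φ.Hull e e') := by
    rw [Hull, closure_Ioo ((min_lt_of_left_lt (hφ.height_tgt_lt e)).trans_le
      (le_max_left _ _)).ne]
    rcases hy with hy | hy
    · exact ⟨min_le_of_left_le hy.1, le_max_of_le_left hy.2⟩
    · exact ⟨min_le_of_right_le hy.1, le_max_of_le_right hy.2⟩
  obtain ⟨z, hz, hzh⟩ := mem_closure_iff.1 hy' _ (isOpen_lt hp.continuous hq.continuous) hlt
  exact isLeft_of_lt_of_mem_hull hp hq he he' hinc hzh hz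

theorem isLeft_total [Finite E] (hφ : φ.IsUpward) (hinc : G.Incomparable e e') :
    IsLeft hφ e e' ∨ IsLeft hφ e' e := by
  obtain ⟨C, p, hp, he⟩ := exists_isThread hφ e
  obtain ⟨D, q, hq, he'⟩ := exists_isThread hφ e'
  obtain ⟨y, -, hy⟩ := exists_mem_hull_of_left hφ e e'
  rcases (hp.ne_of_mem_hull hq he he' hinc hy).lt_or_gt with h | h
  · exact Or.inl (isLeft_of_lt_of_mem_hull hp hq he he' hinc hy h)
  · exact Or.inr (isLeft_of_lt_of_mem_hull hq hp he' he hinc.symm (hull_comm φ e e' ▸ hy) h)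

/-- If `e` and `g` were joined by a path they would share a thread, and at a common height a thread
through `f` would be both to the right and to the left of it. -/
theorem IsLeft.not_pathLE [Finite E] (h : IsLeft hφ e f) (h' : IsLeft hφ f g) :
    ¬ G.PathLE e g ∧ ¬ G.PathLE g e := by
  have key : ∀ C p, IsThread hφ φ.top C p → e ∈ C → g ∈ C → False := by
    intro C p hp he hg
    obtain ⟨D, q, hq, hf⟩ := exists_isThread hφ f
    obtain ⟨y, hy, hy', -⟩ := exists_mem_hull_inter hφ e f g
    exact lt_asymm (h.2 C p D q hp hq he hf y hy) (h'.2 D q C p hq hp hf hg y hy')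
  constructor <;> intro hle <;> obtain ⟨C, p, hp, h1, h2⟩ := exists_isThread_pair hφ hle
  · exact key C p hp h1 h2
  · exact key C p hp h2 h1

theorem IsLeft.asymm [Finite E] (h : IsLeft hφ e f) : ¬ IsLeft hφ f e := fun h' =>
  (h.not_pathLE h').1 (.refl _)

theorem IsLeft.trans [Finite E] (h : IsLeft hφ e f) (h' : IsLeft hφ f g) : IsLeft hφ e g := by
  obtain ⟨C, p, hp, he⟩ := exists_isThread hφ e
  obtain ⟨D, q, hq, hf⟩ := exists_isThread hφ f
  obtain ⟨D', q', hq', hg⟩ := exists_isThread hφ g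
  obtain ⟨y, hy, hy', hy''⟩ := exists_mem_hull_inter hφ e f g
  exact isLeft_of_lt_of_mem_hull hp hq' he hg (h.not_pathLE h') hy''
    ((h.2 C p D q hp hq he hf y hy).trans (h'.2 D q D' q' hq hq' hf hg y hy'))

/-- The order of the edges of an upward embedding from left to right and from up to down. -/
def EdgeLT (hφ : φ.IsUpward) (e e' : E) : Prop := G.EdgePath e e' ∨ IsLeft hφ e e'

theorem isPlanarOrder_edgeLT [Finite E] (hφ : φ.IsUpward) : G.IsPlanarOrder (EdgeLT hφ) where
  irrefl e h := h.elim (hφ.isAcyclic e) fun h => h.asymm h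
  trans e₁ e₂ e₃ := by
    rintro (h | h) (h' | h')
    · exact Or.inl (h.trans h')
    -- Every alternative to `e₁ ≺ e₃` is refuted: equality or a path from `e₃` to `e₁` contradicts
    -- one of the "left" hypotheses, and `e₃` left of `e₁` would, by transitivity, put a pair that
    -- is joined by a path (or already ordered the other way) in "left" position.
    all_goals
      by_cases h13 : G.PathLE e₁ e₃
      · rcases pathLE_iff.1 h13 with rfl | h13
        · first
          | exact absurd h.pathLE h'.1.2
          | exact absurd h'.pathLE h.1.2
          | exact absurd h' h.asymm
        · exact Or.inl h13
      by_cases h31 : G.PathLE e₃ e₁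
      · first
        | exact absurd (h31.trans h.pathLE) h'.1.2
        | exact absurd (h'.pathLE.trans h31) h.1.2
        | exact absurd h31 (h.not_pathLE h').2
      rcases isLeft_total hφ ⟨h13, h31⟩ with hl | hl
      · exact Or.inr hl
      · first
        | exact absurd h.pathLE (h'.trans hl).1.2
        | exact absurd h'.pathLE (hl.trans h).1.2
        | exact absurd hl (h.trans h').asymm
  total e₁ e₂ hne := by
    by_cases h : G.Incomparable e₁ e₂
    · exact (isLeft_total hφ h).imp Or.inr Or.inr
    · rw [incomparable_iff] at h
      simp only [EdgeLT]
      tauto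
  of_path e₁ e₂ h := Or.inl h
  between e₁ e₂ e₃ := by
    rintro (h | h) (h' | h') h13
    · exact Or.inl h
    · exact Or.inl h
    · exact Or.inr h'
    · exact absurd h13.pathLE (h.trans h').1.1

end Threads

/-! ### Strip graphs and the comparison of layer orders with the global order. -/

section Strips

variable {V E : Type*} {G : DirectedMultigraph V E} {φ : BPEmbedding G} {a b : ℝ}

/-- Between the heights `b < a` in the box, all vertices at the height `a` are sources and all
vertices at the height `b` are sinks. -/
structure IsSlab (φ : BPEmbedding G) (a b : ℝ) : Prop where
  lt : b < a
  le_top : a ≤ φ.top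
  bottom_le : φ.bottom ≤ b
  isSource : ∀ v, φ.height v = a → G.IsSource v
  isSink : ∀ v, φ.height v = b → G.IsSink v

theorem stripGraph_src_of_lt {e : φ.StripEdges a b} (h : φ.height (G.src e) < a) :
    (φ.stripGraph a b).src e = Sum.inl ⟨G.src e, e.2.2, h⟩ := dif_pos h

theorem stripGraph_src_of_le {e : φ.StripEdges a b} (h : a ≤ φ.height (G.src e)) :
    (φ.stripGraph a b).src e = Sum.inr (Sum.inl ⟨e, h⟩) := dif_neg h.not_gt

theorem stripGraph_tgt_of_lt {e : φ.StripEdges a b} (h : b < φ.height (G.tgt e)) :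
    (φ.stripGraph a b).tgt e = Sum.inl ⟨G.tgt e, h, e.2.1⟩ := dif_pos h

theorem stripGraph_tgt_of_le {e : φ.StripEdges a b} (h : φ.height (G.tgt e) ≤ b) :
    (φ.stripGraph a b).tgt e = Sum.inr (Sum.inr ⟨e, h⟩) := dif_neg h.not_gt

theorem stripGraph_src_eq_inl {e : φ.StripEdges a b} {v : {v // b < φ.height v ∧ φ.height v < a}} :
    (φ.stripGraph a b).src e = Sum.inl v ↔ G.src e = v := by
  rcases lt_or_ge (φ.height (G.src e)) a with h | h
  · rw [stripGraph_src_of_lt h, Sum.inl.injEq, Subtype.ext_iff]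
  · rw [stripGraph_src_of_le h]
    exact ⟨fun h => (Sum.inr_ne_inl h).elim, fun hv => absurd (hv ▸ v.2.2) h.not_gt⟩

theorem stripGraph_tgt_eq_inl {e : φ.StripEdges a b} {v : {v // b < φ.height v ∧ φ.height v < a}} :
    (φ.stripGraph a b).tgt e = Sum.inl v ↔ G.tgt e = v := by
  rcases lt_or_ge b (φ.height (G.tgt e)) with h | h
  · rw [stripGraph_tgt_of_lt h, Sum.inl.injEq, Subtype.ext_iff]
  · rw [stripGraph_tgt_of_le h]
    exact ⟨fun h => (Sum.inr_ne_inl h).elim, fun hv => absurd (hv ▸ v.2.1) h.not_gt⟩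

/-- Points on the upper line are only starts and points on the lower line only ends, so cutting
creates no new adjacency; none is lost, because edges of the strip end below `a`. -/
theorem stripGraph_tgt_eq_src {e f : φ.StripEdges a b} :
    (φ.stripGraph a b).tgt e = (φ.stripGraph a b).src f ↔ G.tgt e = G.src f := by
  rcases lt_or_ge (φ.height (G.src f)) a with h | h
  · rw [stripGraph_src_of_lt h, stripGraph_tgt_eq_inl]
  · rw [stripGraph_src_of_le h]
    refine ⟨fun heq => ?_, fun heq => absurd (heq ▸ e.2.1) h.not_gt⟩
    rcases lt_or_ge b (φ.height (G.tgt e)) with h' | h'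
    · rw [stripGraph_tgt_of_lt h'] at heq
      cases heq
    · rw [stripGraph_tgt_of_le h'] at heq
      cases heq

/-- The directed paths of a strip are those of the whole graph between edges of the strip. -/
theorem stripGraph_edgePath_iff (hφ : φ.IsUpward) {e f : φ.StripEdges a b} :
    (φ.stripGraph a b).EdgePath e f ↔ G.EdgePath e f := by
  constructor
  · exact Relation.TransGen.lift (p := fun e f => G.tgt e = G.src f) Subtype.val
      (fun _ _ => stripGraph_tgt_eq_src.1) e f
  · suffices ∀ e' : E, G.EdgePath e' f → ∀ he : e' ∈ φ.StripEdges a b,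
        (φ.stripGraph a b).EdgePath ⟨e', he⟩ f from fun h => this e h e.2
    intro e' h
    induction h using Relation.TransGen.head_induction_on with
    | single h => exact fun _ => .single (stripGraph_tgt_eq_src.2 h)
    | @head x c h hc ih =>
      intro he
      have h1 := hφ.height_src_le_height_tgt hc
      have h2 := hφ.height_tgt_lt c
      -- The heights along a path decrease, so the intermediate edges cannot leave the strip.
      have hcs : c ∈ φ.StripEdges a b :=
        ⟨h2.trans (h ▸ he.1), f.2.2.trans_le (h1.trans h2.le)⟩
      have hstep : (φ.stripGraph a b).tgt ⟨x, he⟩ = (φ.stripGraph a b).src ⟨c, hcs⟩ :=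
        stripGraph_tgt_eq_src.2 h
      exact Relation.TransGen.head hstep (ih hcs)

theorem stripGraph_degree_inr_inl (e : {e : φ.StripEdges a b // a ≤ φ.height (G.src e)}) :
    (φ.stripGraph a b).degree (Sum.inr (Sum.inl e)) = 1 := by
  have h1 : Nat.card {f // (φ.stripGraph a b).src f = Sum.inr (Sum.inl e)} = 1 := by
    rw [Nat.card_eq_one_iff_exists]
    refine ⟨⟨e, stripGraph_src_of_le e.2⟩, fun ⟨f, hf⟩ => Subtype.ext ?_⟩
    rcases lt_or_ge (φ.height (G.src f)) a with h | h
    · rw [stripGraph_src_of_lt h] at hf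
      cases hf
    · rw [stripGraph_src_of_le h] at hf
      cases hf
      rfl
  have h2 : IsEmpty {f // (φ.stripGraph a b).tgt f = Sum.inr (Sum.inl e)} := by
    refine ⟨fun ⟨f, hf⟩ => ?_⟩
    rcases lt_or_ge b (φ.height (G.tgt f)) with h | h
    · rw [stripGraph_tgt_of_lt h] at hf
      cases hf
    · rw [stripGraph_tgt_of_le h] at hf
      cases hf
  rw [degree, h1, Nat.card_of_isEmpty]

theorem stripGraph_degree_inr_inr (e : {e : φ.StripEdges a b // φ.height (G.tgt e) ≤ b}) :
    (φ.stripGraph a b).degree (Sum.inr (Sum.inr e)) = 1 := by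
  have h1 : Nat.card {f // (φ.stripGraph a b).tgt f = Sum.inr (Sum.inr e)} = 1 := by
    rw [Nat.card_eq_one_iff_exists]
    refine ⟨⟨e, stripGraph_tgt_of_le e.2⟩, fun ⟨f, hf⟩ => Subtype.ext ?_⟩
    rcases lt_or_ge b (φ.height (G.tgt f)) with h | h
    · rw [stripGraph_tgt_of_lt h] at hf
      cases hf
    · rw [stripGraph_tgt_of_le h] at hf
      cases hf
      rfl
  have h2 : IsEmpty {f // (φ.stripGraph a b).src f = Sum.inr (Sum.inr e)} := by
    refine ⟨fun ⟨f, hf⟩ => ?_⟩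
    rcases lt_or_ge (φ.height (G.src f)) a with h | h
    · rw [stripGraph_src_of_lt h] at hf
      cases hf
    · rw [stripGraph_src_of_le h] at hf
      cases hf
  rw [degree, h1, Nat.card_of_isEmpty]

theorem stripGraph_degree_inr (x) : (φ.stripGraph a b).degree (Sum.inr x) = 1 := by
  rcases x with e | e
  · exact stripGraph_degree_inr_inl e
  · exact stripGraph_degree_inr_inr e

theorem IsSlab.exists_tgt_eq (hs : φ.IsSlab a b) (hφ : φ.IsUpward)
    (v : {v // b < φ.height v ∧ φ.height v < a}) :
    ∃ e, (φ.stripGraph a b).tgt e = Sum.inl v := by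
  obtain ⟨e, he⟩ := not_forall_not.1 fun h =>
    (v.2.2.trans_le hs.le_top).ne (φ.source_top v h)
  have h := hφ.height_tgt_lt e
  rw [he] at h
  exact ⟨⟨e, he ▸ v.2.2, v.2.1.trans h⟩, stripGraph_tgt_eq_inl.2 he⟩

theorem IsSlab.exists_src_eq (hs : φ.IsSlab a b) (hφ : φ.IsUpward)
    (v : {v // b < φ.height v ∧ φ.height v < a}) :
    ∃ e, (φ.stripGraph a b).src e = Sum.inl v := by
  obtain ⟨e, he⟩ := not_forall_not.1 fun h =>
    (hs.bottom_le.trans_lt v.2.1).ne' (φ.sink_bottom v h)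
  have h := hφ.height_tgt_lt e
  rw [he] at h
  exact ⟨⟨e, h.trans v.2.2, he ▸ v.2.1⟩, stripGraph_src_eq_inl.2 he⟩

/-- A vertex strictly inside the strip is off the horizontal sides of the box, hence neither source
nor sink: it has an incoming and an outgoing edge. Finiteness matters, since `Nat.card` of an
infinite type is zero. -/
theorem IsSlab.isInternal_inl [Finite E] (hs : φ.IsSlab a b) (hφ : φ.IsUpward)
    (v : {v // b < φ.height v ∧ φ.height v < a}) : (φ.stripGraph a b).IsInternal (Sum.inl v) := by
  obtain ⟨e, he⟩ := hs.exists_tgt_eq hφ v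
  obtain ⟨f, hf⟩ := hs.exists_src_eq hφ v
  have h1 : 0 < Nat.card {e // (φ.stripGraph a b).tgt e = Sum.inl v} :=
    Nat.card_pos_iff.2 ⟨⟨e, he⟩, inferInstance⟩
  have h2 : 0 < Nat.card {e // (φ.stripGraph a b).src e = Sum.inl v} :=
    Nat.card_pos_iff.2 ⟨⟨f, hf⟩, inferInstance⟩
  rw [IsInternal, IsBoundary, degree]
  omega

theorem IsSlab.isInput_iff [Finite E] (hs : φ.IsSlab a b) (hφ : φ.IsUpward)
    {e : φ.StripEdges a b} : (φ.stripGraph a b).IsInput e ↔ a ≤ φ.height (G.src e) := by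
  rcases lt_or_ge (φ.height (G.src e)) a with h | h
  · rw [IsInput, stripGraph_src_of_lt h]
    exact ⟨fun h' => absurd h' (hs.isInternal_inl hφ _), fun h' => absurd h h'.not_gt⟩
  · rw [IsInput, stripGraph_src_of_le h]
    exact ⟨fun _ => h, fun _ => stripGraph_degree_inr _⟩

theorem IsSlab.isOutput_iff [Finite E] (hs : φ.IsSlab a b) (hφ : φ.IsUpward)
    {e : φ.StripEdges a b} : (φ.stripGraph a b).IsOutput e ↔ φ.height (G.tgt e) ≤ b := by
  rcases lt_or_ge b (φ.height (G.tgt e)) with h | h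
  · rw [IsOutput, stripGraph_tgt_of_lt h]
    exact ⟨fun h' => absurd h' (hs.isInternal_inl hφ _), fun h' => absurd h h'.not_gt⟩
  · rw [IsOutput, stripGraph_tgt_of_le h]
    exact ⟨fun _ => h, fun _ => stripGraph_degree_inr _⟩

theorem IsSlab.isProgressive_stripGraph (hs : φ.IsSlab a b) (hφ : φ.IsUpward) :
    (φ.stripGraph a b).IsProgressive where
  acyclic e h := hφ.isAcyclic e ((stripGraph_edgePath_iff hφ).1 h)
  degree_source := by
    rintro (v | x) h
    · obtain ⟨e, he⟩ := hs.exists_tgt_eq hφ v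
      exact absurd he (h e)
    · exact stripGraph_degree_inr x
  degree_sink := by
    rintro (v | x) h
    · obtain ⟨e, he⟩ := hs.exists_src_eq hφ v
      exact absurd he (h e)
    · exact stripGraph_degree_inr x

/-- An edge with two internal ends would, in an elementary graph, be a loop. -/
theorem IsSlab.isInput_or_isOutput [Finite E] (hs : φ.IsSlab a b) (hφ : φ.IsUpward)
    (hel : (φ.stripGraph a b).IsElementary) (e : φ.StripEdges a b) :
    (φ.stripGraph a b).IsInput e ∨ (φ.stripGraph a b).IsOutput e := by
  by_contra! h
  have := hel _ _ h.1 h.2 (.rel _ _ ⟨e, rfl, rfl⟩)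
  exact (hs.isProgressive_stripGraph hφ).acyclic e (.single this.symm)

theorem mem_span_upper {e : φ.StripEdges a b} (h : a ≤ φ.height (G.src e)) : a ∈ φ.Span e :=
  ⟨e.2.1.le, h⟩

theorem mem_span_lower {e : φ.StripEdges a b} (h : φ.height (G.tgt e) ≤ b) : b ∈ φ.Span e :=
  ⟨h, e.2.2.le⟩

theorem eq_of_src_eq {G : DirectedMultigraph V E} (hG : G.IsProgressive) {e f : E}
    (hs : G.IsSource (G.src e)) (h : G.src f = G.src e) : f = e := by
  have hd := hG.degree_source _ hs
  have : IsEmpty {f // G.tgt f = G.src e} := ⟨fun f => hs f f.2⟩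
  rw [degree, Nat.card_of_isEmpty (α := {f // G.tgt f = G.src e}), add_zero,
    Nat.card_eq_one_iff_unique] at hd
  have := hd.1
  exact congrArg Subtype.val (Subsingleton.elim (⟨f, h⟩ : {f // G.src f = G.src e}) ⟨e, rfl⟩)

theorem eq_of_tgt_eq {G : DirectedMultigraph V E} (hG : G.IsProgressive) {e f : E}
    (hs : G.IsSink (G.tgt e)) (h : G.tgt f = G.tgt e) : f = e := by
  have hd := hG.degree_sink _ hs
  have : IsEmpty {f // G.src f = G.tgt e} := ⟨fun f => hs f f.2⟩
  rw [degree, Nat.card_of_isEmpty, zero_add, Nat.card_eq_one_iff_unique] at hd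
  have := hd.1
  exact congrArg Subtype.val (Subsingleton.elim (⟨f, h⟩ : {f // G.tgt f = G.tgt e}) ⟨e, rfl⟩)

/-- Distinct edges that met on the upper line would both start at a vertex there; in a slab it is a
source, and sources have degree one. -/
theorem IsSlab.leftAt_upper_total (hs : φ.IsSlab a b) (hG : G.IsProgressive) (hφ : φ.IsUpward)
    {e f : φ.StripEdges a b} (he : a ≤ φ.height (G.src e)) (hf : a ≤ φ.height (G.src f))
    (hne : (e : E) ≠ f) : φ.LeftAt a e f ∨ φ.LeftAt a f e := by
  have hes := mem_span_upper he
  have hfs := mem_span_upper hf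
  simp only [leftAt_iff hφ, hes, hfs, true_and]
  refine lt_or_gt_of_ne fun heq => ?_
  obtain ⟨v, hv, hev, hfv⟩ := exists_common_end hφ hne hes hfs heq
  have hev : G.src e = v := hev.resolve_right fun h => e.2.1.ne (by rw [h, hv])
  have hfv : G.src f = v := hfv.resolve_right fun h => f.2.1.ne (by rw [h, hv])
  subst hev
  exact hne (eq_of_src_eq hG (hs.isSource _ hv) hfv).symm

theorem IsSlab.leftAt_lower_total (hs : φ.IsSlab a b) (hG : G.IsProgressive) (hφ : φ.IsUpward)
    {e f : φ.StripEdges a b} (he : φ.height (G.tgt e) ≤ b) (hf : φ.height (G.tgt f) ≤ b)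
    (hne : (e : E) ≠ f) : φ.LeftAt b e f ∨ φ.LeftAt b f e := by
  have hes := mem_span_lower he
  have hfs := mem_span_lower hf
  simp only [leftAt_iff hφ, hes, hfs, true_and]
  refine lt_or_gt_of_ne fun heq => ?_
  obtain ⟨v, hv, hev, hfv⟩ := exists_common_end hφ hne hes hfs heq
  have hev : G.tgt e = v := hev.resolve_left fun h => e.2.2.ne' (by rw [h, hv])
  have hfv : G.tgt f = v := hfv.resolve_left fun h => f.2.2.ne' (by rw [h, hv])
  subst hev
  exact hne (eq_of_tgt_eq hG (hs.isSink _ hv) hfv).symm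

/-- This justifies replacing an edge by one that leads to it: a thread through both edges carries
the comparison over. -/
theorem isLeft_of_leftAt [Finite E] (hφ : φ.IsUpward) {e e' f f' : E} {y : ℝ}
    (h : φ.LeftAt y f f') (hinc : G.Incomparable e e') (hf : G.PathLE f e) (hf' : G.PathLE f' e')
    (hy : y ∈ φ.Span e ∪ φ.Span e') : IsLeft hφ e e' := by
  obtain ⟨C, p, hp, hfC, he⟩ := exists_isThread_pair hφ hf
  obtain ⟨D, q, hq, hfD, he'⟩ := exists_isThread_pair hφ hf'
  obtain ⟨h1, h2, h3⟩ := (leftAt_iff hφ).1 h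
  rw [← hp.agree f hfC y h1, ← hq.agree f' hfD y h2] at h3
  exact isLeft_of_lt hp hq he he' hinc hy h3

theorem IsSlab.isLeft_of_layerLeft [Finite E] (hs : φ.IsSlab a b) (hφ : φ.IsUpward)
    {e e' : φ.StripEdges a b} (hinc : G.Incomparable e e') (h : φ.LayerLeft a b e e') :
    IsLeft hφ (e : E) e' := by
  simp only [LayerLeft, hs.isInput_iff hφ, hs.isOutput_iff hφ, stripGraph_edgePath_iff hφ] at h
  rcases h with ⟨he, -, h⟩ | ⟨he, -, h⟩ | ⟨he, f', -, hf', h⟩ | ⟨he', f, -, hf, h⟩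
  · exact isLeft_of_leftAt hφ h hinc (.refl _) (.refl _) (Or.inl (mem_span_upper he))
  · exact isLeft_of_leftAt hφ h hinc (.refl _) (.refl _) (Or.inl (mem_span_lower he))
  · exact isLeft_of_leftAt hφ h hinc (.refl _) hf'.pathLE (Or.inl (mem_span_upper he))
  · exact isLeft_of_leftAt hφ h hinc hf.pathLE (.refl _) (Or.inr (mem_span_upper he'))

theorem not_layerLeft_self [Finite E] (hs : φ.IsSlab a b) (hφ : φ.IsUpward)
    (e : φ.StripEdges a b) : ¬ φ.LayerLeft a b e e := by
  simp only [LayerLeft, hs.isInput_iff hφ, stripGraph_edgePath_iff hφ, leftAt_iff hφ, lt_irrefl,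
    and_false, false_or, not_or, not_and, not_exists]
  exact ⟨fun he f' _ hf' => absurd ((he.trans (hφ.height_src_le_height_tgt hf')).trans_lt f'.2.1)
    (lt_irrefl _), fun he f' _ hf' => absurd
    ((he.trans (hφ.height_src_le_height_tgt hf')).trans_lt f'.2.1) (lt_irrefl _)⟩

/-- If `e'` does not reach the upper line, it starts at an inner vertex. An edge `f` entering that
vertex is no output edge, so it is an input edge and can be compared with `e`; incomparability
excludes `e = f`. -/
theorem IsSlab.layerLeft_total_of_isInput [Finite E] (hs : φ.IsSlab a b) (hG : G.IsProgressive)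
    (hφ : φ.IsUpward) (hel : (φ.stripGraph a b).IsElementary) {e e' : φ.StripEdges a b}
    (hinc : G.Incomparable e e') (he : (φ.stripGraph a b).IsInput e) :
    φ.LayerLeft a b e e' ∨ φ.LayerLeft a b e' e := by
  by_cases he' : (φ.stripGraph a b).IsInput e'
  · exact (hs.leftAt_upper_total hG hφ ((hs.isInput_iff hφ).1 he) ((hs.isInput_iff hφ).1 he')
      (incomparable_iff.1 hinc).1).imp (fun h => Or.inl ⟨he, he', h⟩) fun h => Or.inl ⟨he', he, h⟩
  have hlt : φ.height (G.src e') < a := not_le.1 fun h => he' ((hs.isInput_iff hφ).2 h)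
  obtain ⟨f, hf⟩ := hs.exists_tgt_eq hφ ⟨G.src e', e'.2.2, hlt⟩
  have hfin : (φ.stripGraph a b).IsInput f :=
    (hs.isInput_or_isOutput hφ hel f).resolve_right fun h => by
      rw [IsOutput, hf] at h
      exact hs.isInternal_inl hφ _ h
  have hfe : (φ.stripGraph a b).EdgePath f e' :=
    .single (hf.trans (stripGraph_src_of_lt hlt).symm)
  have hne : (e : E) ≠ f := fun h => hinc.1 (h ▸ ((stripGraph_edgePath_iff hφ).1 hfe).pathLE)
  exact (hs.leftAt_upper_total hG hφ ((hs.isInput_iff hφ).1 he) ((hs.isInput_iff hφ).1 hfin)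
    hne).imp (fun h => Or.inr (Or.inr (Or.inl ⟨he, f, hfin, hfe, h⟩)))
    fun h => Or.inr (Or.inr (Or.inr ⟨he, f, hfin, hfe, h⟩))

theorem IsSlab.layerLeft_total [Finite E] (hs : φ.IsSlab a b) (hG : G.IsProgressive)
    (hφ : φ.IsUpward) (hel : (φ.stripGraph a b).IsElementary) {e e' : φ.StripEdges a b}
    (hinc : G.Incomparable e e') : φ.LayerLeft a b e e' ∨ φ.LayerLeft a b e' e := by
  rcases hs.isInput_or_isOutput hφ hel e with he | he
  · exact hs.layerLeft_total_of_isInput hG hφ hel hinc he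
  rcases hs.isInput_or_isOutput hφ hel e' with he' | he'
  · exact (hs.layerLeft_total_of_isInput hG hφ hel hinc.symm he').symm
  · exact (hs.leftAt_lower_total hG hφ ((hs.isOutput_iff hφ).1 he) ((hs.isOutput_iff hφ).1 he')
      (incomparable_iff.1 hinc).1).imp (fun h => Or.inr (Or.inl ⟨he, he', h⟩))
      fun h => Or.inr (Or.inl ⟨he', he, h⟩)

theorem IsSlab.layerLT_iff [Finite E] (hs : φ.IsSlab a b) (hG : G.IsProgressive)
    (hφ : φ.IsUpward) (hel : (φ.stripGraph a b).IsElementary) {e e' : φ.StripEdges a b} :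
    φ.LayerLT a b e e' ↔ EdgeLT hφ (e : E) e' := by
  rw [LayerLT, EdgeLT]
  simp only [stripGraph_edgePath_iff hφ]
  -- Only the passage from `LayerLeft` to `IsLeft` is geometric; the converse follows from totality
  -- of the former and asymmetry of the latter.
  refine or_congr_right ⟨fun ⟨h, h', hl⟩ => ?_, fun h => ?_⟩
  · by_cases hee : (e : E) = e'
    · exact absurd (Subtype.ext hee ▸ hl) (not_layerLeft_self hs hφ e)
    · exact hs.isLeft_of_layerLeft hφ (incomparable_iff.2 ⟨hee, h, h'⟩) hl
  · obtain ⟨-, h1, h2⟩ := incomparable_iff.1 h.1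
    refine ⟨h1, h2, (hs.layerLeft_total hG hφ hel h.1).resolve_right fun h' => ?_⟩
    exact h.asymm (hs.isLeft_of_layerLeft hφ h.1.symm h')

end Strips

end BPEmbedding

/-! ### Composition of restrictions of one linear order. -/

namespace OrderedEdges

/-- The restriction of a relation to a set of edges. -/
def restrict {E : Type*} (r : E → E → Prop) (A : Set E) : OrderedEdges E where
  carrier := A
  lt e e' := e ∈ A ∧ e' ∈ A ∧ r e e'

/-- Restrictions of a linear order compose to a restriction of this order if between any edges
`e ≺ e'`, one on each side of the seam, there is an edge of the seam. -/
theorem restrict_comp_restrict {E : Type*} {r : E → E → Prop} {A B : Set E}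
    (htrans : ∀ e f g, r e f → r f g → r e g) (hasymm : ∀ e f, r e f → ¬ r f e)
    (htotal : ∀ e f, e ≠ f → r e f ∨ r f e)
    (hseam : ∀ e ∈ A \ B, ∀ f ∈ B \ A, r e f → ∃ s ∈ A ∩ B, r e s ∧ r s f) :
    (restrict r B).comp (restrict r A) = restrict r (A ∪ B) := by
  -- The seam condition in the definition of `comp` is equivalent to `r e f`, so its negation in the
  -- last clause is the reverse relation by totality.
  have key : ∀ e ∈ A \ B, ∀ f ∈ B \ A,
      (∃ s ∈ A ∩ B, (e ∈ A ∧ s ∈ A ∧ r e s) ∧ (s ∈ B ∧ f ∈ B ∧ r s f)) ↔ r e f := by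
    intro e he f hf
    constructor
    · rintro ⟨s, -, ⟨-, -, h⟩, -, -, h'⟩
      exact htrans _ _ _ h h'
    · intro h
      obtain ⟨s, hs, h1, h2⟩ := hseam e he f hf h
      exact ⟨s, hs, ⟨he.1, hs.1, h1⟩, hs.2, hf.1, h2⟩
  refine OrderedEdges.ext rfl ?_
  funext e f
  refine propext ⟨?_, ?_⟩
  · rintro (⟨he, hf, -, -, h⟩ | ⟨he, hf, -, -, h⟩ | ⟨he, hf, h⟩ | ⟨he, hf, h⟩)
    · exact ⟨Or.inl he, Or.inl hf, h⟩
    · exact ⟨Or.inr he, Or.inr hf, h⟩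
    · exact ⟨Or.inl he.1, Or.inr hf.1, (key e he f hf).1 h⟩
    · have hne : e ≠ f := fun h => he.2 (h ▸ hf.1)
      exact ⟨Or.inr he.1, Or.inl hf.1,
        (htotal e f hne).resolve_right fun h' => h ((key f hf e he).2 h')⟩
  · rintro ⟨he, hf, h⟩
    by_cases heA : e ∈ A <;> by_cases hfA : f ∈ A
    · exact Or.inl ⟨heA, hfA, heA, hfA, h⟩
    · have hfB := hf.resolve_left hfA
      by_cases heB : e ∈ B
      · exact Or.inr (Or.inl ⟨heB, hfB, heB, hfB, h⟩)
      · exact Or.inr (Or.inr (Or.inl ⟨⟨heA, heB⟩, ⟨hfB, hfA⟩,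
          (key e ⟨heA, heB⟩ f ⟨hfB, hfA⟩).2 h⟩))
    · have heB := he.resolve_left heA
      by_cases hfB : f ∈ B
      · exact Or.inr (Or.inl ⟨heB, hfB, heB, hfB, h⟩)
      · exact Or.inr (Or.inr (Or.inr ⟨⟨heB, heA⟩, ⟨hfA, hfB⟩,
          fun h' => hasymm _ _ h ((key f ⟨hfA, hfB⟩ e ⟨heB, heA⟩).1 h')⟩))
    · exact Or.inr (Or.inl ⟨he.resolve_left heA, hf.resolve_left hfA, he.resolve_left heA,
        hf.resolve_left hfA, h⟩)

end OrderedEdges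

namespace BPEmbedding

open DirectedMultigraph Set

/-! ### Seams, composites of layers and existence of cuts. -/

section Cuts

variable {V E : Type*} {G : DirectedMultigraph V E} {φ : BPEmbedding G} {a b c : ℝ} {n : ℕ}
  {y : ℕ → ℝ}

theorem stripEdges_union (hφ : φ.IsUpward) (hbc : b < c) (hca : c < a) :
    φ.StripEdges a c ∪ φ.StripEdges c b = φ.StripEdges a b := by
  ext e
  have := hφ.height_tgt_lt e
  simp only [StripEdges, mem_union, mem_ofPred_eq]
  constructor
  · rintro (⟨h, h'⟩ | ⟨h, h'⟩)
    · exact ⟨h, hbc.trans h'⟩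
    · exact ⟨h.trans hca, h'⟩
  · rintro ⟨h, h'⟩
    rcases lt_or_ge c (φ.height (G.src e)) with h1 | h1
    · exact Or.inl ⟨h, h1⟩
    · exact Or.inr ⟨this.trans_le h1, h'⟩

/-- A directed path from above the height `c` to below it crosses this height. -/
theorem exists_crossing (hc : ∀ v, φ.height v ≠ c) {e f : E}
    (he : c < φ.height (G.src e)) (hf : φ.height (G.tgt f) < c) (h : G.PathLE e f) :
    ∃ s, φ.height (G.tgt s) < c ∧ c < φ.height (G.src s) ∧ G.PathLE e s ∧ G.PathLE s f := by
  induction h using Relation.ReflTransGen.head_induction_on with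
  | refl => exact ⟨f, hf, he, .refl _, .refl _⟩
  | @head e g h hg ih =>
    rcases (hc (G.tgt e)).lt_or_gt with h' | h'
    · exact ⟨e, h', he, .refl _, (PathLE.single h).trans hg⟩
    · obtain ⟨s, h1, h2, h3, h4⟩ := ih (h ▸ h')
      exact ⟨s, h1, h2, (PathLE.single h).trans h3, h4⟩

theorem exists_sink_pathLE [Finite E] (hφ : φ.IsUpward) (e : E) :
    ∃ f, G.PathLE e f ∧ G.IsSink (G.tgt f) := by
  induction e using (wellFounded_height_lt φ).induction with
  | _ e ih =>
    by_cases h : G.IsSink (G.tgt e)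
    · exact ⟨e, .refl _, h⟩
    · obtain ⟨g, hg⟩ := not_forall_not.1 h
      obtain ⟨f, hf, hs⟩ := ih g (hg ▸ hφ.height_tgt_lt e)
      exact ⟨f, (PathLE.single hg.symm).trans hf, hs⟩

/-- A planar order has an edge of the seam between an edge above and an edge below the seam. -/
theorem exists_seam_between [Finite E] (hφ : φ.IsUpward) {r : E → E → Prop}
    (hr : G.IsPlanarOrder r) (hcb : φ.bottom < c) (hc : ∀ v, φ.height v ≠ c) {e f : E}
    (he : c < φ.height (G.tgt e)) (hf : φ.height (G.src f) < c) (hef : r e f) :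
    ∃ s, φ.height (G.tgt s) < c ∧ c < φ.height (G.src s) ∧ r e s ∧ r s f := by
  have he' := he.trans (hφ.height_tgt_lt e)
  have hf' := (hφ.height_tgt_lt f).trans hf
  have of_pathLE : ∀ {x z}, x ≠ z → G.PathLE x z → r x z := fun hne h =>
    hr.of_path _ _ ((pathLE_iff.1 h).resolve_left hne)
  have crossing_of_path : G.EdgePath e f →
      ∃ s, φ.height (G.tgt s) < c ∧ c < φ.height (G.src s) ∧ r e s ∧ r s f := fun h => by
    obtain ⟨s, h1, h2, h3, h4⟩ := exists_crossing hc he' hf' h.pathLE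
    exact ⟨s, h1, h2, of_pathLE (by rintro rfl; exact lt_asymm he h1) h3,
      of_pathLE (by rintro rfl; exact lt_asymm hf h2) h4⟩
  -- A path from `e` down to a sink crosses the seam in some `s` with `e → s`; only the position of
  -- `s` relative to `f` is open.
  obtain ⟨o, ho, hsink⟩ := exists_sink_pathLE hφ e
  obtain ⟨s, h1, h2, h3, -⟩ :=
    exists_crossing hc he' ((φ.sink_bottom _ hsink).trans_lt hcb) ho
  have hes : e ≠ s := by rintro rfl; exact lt_asymm he h1
  rcases hr.total s f (by rintro rfl; exact lt_asymm hf h2) with hsf | hfs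
  · exact ⟨s, h1, h2, of_pathLE hes h3, hsf⟩
  -- Here `e ≺ f ≺ s` and `e → s`, so (P₂) applies. Heights exclude `f → s`, and a path `e → f`
  -- crosses the seam itself.
  · rcases hr.between e f s hef hfs ((pathLE_iff.1 h3).resolve_left hes) with h | h
    · exact crossing_of_path h
    · exact absurd ((hφ.height_src_le_height_tgt h).trans_lt (hφ.height_tgt_lt f))
        (hf.trans h2).not_gt

theorem restrict_comp_stripEdges [Finite E] (hφ : φ.IsUpward) {r : E → E → Prop}
    (hr : G.IsPlanarOrder r) (hcb : φ.bottom < c) (hc : ∀ v, φ.height v ≠ c) (hbc : b < c)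
    (hca : c < a) :
    (OrderedEdges.restrict r (φ.StripEdges c b)).comp
      (OrderedEdges.restrict r (φ.StripEdges a c)) =
    OrderedEdges.restrict r (φ.StripEdges a b) := by
  rw [OrderedEdges.restrict_comp_restrict hr.trans
    (fun e f h h' => hr.irrefl e (hr.trans _ _ _ h h')) hr.total, stripEdges_union hφ hbc hca]
  rintro e ⟨he, he'⟩ f ⟨hf, hf'⟩ h
  have h1 : c < φ.height (G.tgt e) := (not_lt.1 fun h => he' ⟨h, hbc.trans he.2⟩).lt_of_ne'
    (hc _)
  have h2 : φ.height (G.src f) < c := (not_lt.1 fun h => hf' ⟨hf.1.trans hca, h⟩).lt_of_ne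
    (hc _)
  obtain ⟨s, hs, hs', hes, hsf⟩ := exists_seam_between hφ hr hcb hc h1 h2 h
  exact ⟨s, ⟨⟨hs.trans hca, hs'⟩, hs, hbc.trans hs'⟩, hes, hsf⟩

theorem isSource_of_height_eq_top (hφ : φ.IsUpward) {v : V} (h : φ.height v = φ.top) :
    G.IsSource v := by
  rintro e rfl
  exact (hφ.height_tgt_lt e).not_ge (h ▸ φ.height_le_top _)

theorem isSink_of_height_eq_bottom (hφ : φ.IsUpward) {v : V} (h : φ.height v = φ.bottom) :
    G.IsSink v := by
  rintro e rfl
  exact (hφ.height_tgt_lt e).not_ge (h ▸ φ.bottom_le_height _)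

theorem IsElementaryCut.le_top (hy : φ.IsElementaryCut n y) {k : ℕ} (hk : k ≤ n + 1) :
    y k ≤ φ.top := by
  induction k with
  | zero => exact hy.first.le
  | succ k ih => exact (hy.decreasing k (by omega)).le.trans (ih (by omega))

theorem IsElementaryCut.lt_top (hy : φ.IsElementaryCut n y) {k : ℕ} (hk : k ≤ n) :
    y (k + 1) < φ.top :=
  (hy.decreasing k hk).trans_le (hy.le_top (by omega))

theorem IsElementaryCut.bottom_lt (hy : φ.IsElementaryCut n y) {k : ℕ} (hk : k ≤ n) :
    φ.bottom < y k := by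
  induction hk using Nat.decreasingInduction with
  | self => exact hy.last ▸ hy.decreasing n le_rfl
  | of_succ k hk ih => exact ih.trans (hy.decreasing k (by omega))

theorem IsElementaryCut.isSource (hy : φ.IsElementaryCut n y) (hφ : φ.IsUpward) {k : ℕ}
    (hk : k ≤ n) (v : V) (hv : φ.height v = y k) : G.IsSource v := by
  rcases k with _ | k
  · exact isSource_of_height_eq_top hφ (hv.trans hy.first)
  · exact absurd hv (hy.avoids k hk v)

theorem IsElementaryCut.isSink (hy : φ.IsElementaryCut n y) (hφ : φ.IsUpward) {k : ℕ}
    (hk : k ≤ n) (v : V) (hv : φ.height v = y (k + 1)) : G.IsSink v := by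
  rcases hk.eq_or_lt with rfl | hk
  · exact isSink_of_height_eq_bottom hφ (hv.trans hy.last)
  · exact absurd hv (hy.avoids k hk v)

theorem IsElementaryCut.bottom_le (hy : φ.IsElementaryCut n y) {k : ℕ} (hk : k ≤ n) :
    φ.bottom ≤ y (k + 1) := by
  rcases hk.eq_or_lt with rfl | hk
  · exact hy.last.ge
  · exact (hy.bottom_lt hk).le

theorem IsElementaryCut.isSlab (hy : φ.IsElementaryCut n y) (hφ : φ.IsUpward) {k : ℕ}
    (hk : k ≤ n) : φ.IsSlab (y k) (y (k + 1)) where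
  lt := hy.decreasing k hk
  le_top := hy.le_top (by omega)
  bottom_le := hy.bottom_le hk
  isSource := hy.isSource hφ hk
  isSink := hy.isSink hφ hk

theorem IsElementaryCut.isSlab_upper (hy : φ.IsElementaryCut n y) (hφ : φ.IsUpward) {k : ℕ}
    (hk : k ≤ n) : φ.IsSlab (y 0) (y (k + 1)) where
  lt := hy.first ▸ hy.lt_top hk
  le_top := hy.le_top (by omega)
  bottom_le := hy.bottom_le hk
  isSource := hy.isSource hφ (Nat.zero_le _)
  isSink := hy.isSink hφ hk

theorem IsElementaryCut.layer_eq [Finite E] (hy : φ.IsElementaryCut n y) (hG : G.IsProgressive)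
    (hφ : φ.IsUpward) {k : ℕ} (hk : k ≤ n) :
    φ.layer (y k) (y (k + 1)) =
      OrderedEdges.restrict (EdgeLT hφ) (φ.StripEdges (y k) (y (k + 1))) := by
  refine OrderedEdges.ext rfl ?_
  funext e e'
  simp only [layer, OrderedEdges.restrict, exists_prop', (hy.isSlab hφ hk).layerLT_iff hG hφ
    (hy.elementary k hk)]
  simp

theorem IsElementaryCut.composite_eq [Finite E] (hy : φ.IsElementaryCut n y)
    (hG : G.IsProgressive) (hφ : φ.IsUpward) {k : ℕ} (hk : k ≤ n) :
    φ.composite y k = OrderedEdges.restrict (EdgeLT hφ) (φ.StripEdges (y 0) (y (k + 1))) := by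
  induction k with
  | zero => exact hy.layer_eq hG hφ hk
  | succ k ih =>
    rw [composite, ih (by omega), hy.layer_eq hG hφ hk]
    exact restrict_comp_stripEdges hφ (isPlanarOrder_edgeLT hφ) (hy.bottom_lt hk)
      (hy.avoids k hk) (hy.decreasing _ hk) (hy.first ▸ hy.lt_top (by omega))

theorem IsElementaryCut.isPlanarOrder_layerLT [Finite E] (hy : φ.IsElementaryCut n y)
    (hG : G.IsProgressive) (hφ : φ.IsUpward) {k : ℕ} (hk : k ≤ n) :
    (φ.stripGraph (y k) (y (k + 1))).IsPlanarOrder (φ.LayerLT (y k) (y (k + 1))) := by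
  have hr := isPlanarOrder_edgeLT hφ
  have hlt := fun e e' => (hy.isSlab hφ hk).layerLT_iff (e := e) (e' := e') hG hφ
    (hy.elementary k hk)
  constructor <;> simp only [hlt, stripGraph_edgePath_iff hφ]
  · exact fun e => hr.irrefl e
  · exact fun e f g => hr.trans e f g
  · exact fun e f h => hr.total e f (Subtype.coe_ne_coe.2 h)
  · exact fun e f => hr.of_path e f
  · exact fun e f g => hr.between e f g

theorem IsElementaryCut.seamMatches [Finite E] (hy : φ.IsElementaryCut n y)
    (hG : G.IsProgressive) (hφ : φ.IsUpward) {k : ℕ} (hk : k < n) : φ.SeamMatches y k := by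
  have h0 : y (k + 1) < y 0 := hy.first ▸ hy.lt_top hk.le
  have h1 : y (k + 2) < y (k + 1) := hy.decreasing _ hk
  have hav := hy.avoids k hk
  refine ⟨?_, ?_, ?_⟩ <;> rw [hy.composite_eq hG hφ hk.le, hy.layer_eq hG hφ hk]
  · ext e
    simp only [OrderedEdges.restrict, (hy.isSlab_upper hφ hk.le).isOutput_iff hφ, mem_image,
      mem_ofPred_eq, Subtype.exists, exists_and_right, exists_eq_right]
    refine ⟨fun h => ⟨h.1, h.2.1.le⟩, fun ⟨h, h'⟩ => ⟨h, h'.lt_of_ne (hav _), h1.trans h.2⟩⟩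
  · ext e
    simp only [OrderedEdges.restrict, (hy.isSlab hφ hk).isInput_iff hφ, mem_image,
      mem_ofPred_eq, Subtype.exists, exists_and_right, exists_eq_right]
    refine ⟨fun h => ⟨h.2, h.1.2.le⟩, fun ⟨h, h'⟩ => ⟨⟨h.1.trans h0, h'.lt_of_ne' (hav _)⟩, h⟩⟩
  · rintro e ⟨he, he'⟩ f ⟨hf, hf'⟩
    exact ⟨fun h => ⟨he', hf', h.2.2⟩, fun h => ⟨he, hf, h.2.2⟩⟩

theorem IsElementaryCut.composite_last [Finite E] (hy : φ.IsElementaryCut n y)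
    (hG : G.IsProgressive) (hφ : φ.IsUpward) :
    φ.composite y n = OrderedEdges.restrict (EdgeLT hφ) univ := by
  rw [hy.composite_eq hG hφ le_rfl, hy.first, hy.last]
  congr
  refine eq_univ_of_forall fun e => ⟨?_, ?_⟩
  · exact (hφ.height_tgt_lt e).trans_le (φ.height_le_top _)
  · exact (φ.bottom_le_height _).trans_lt (hφ.height_tgt_lt e)

/-- The vertices of `φ` in a strip that are equal or joined to a given vertex of the strip graph. -/
def stripCentre (φ : BPEmbedding G) (a b : ℝ) : φ.StripVertex a b → Set V
  | Sum.inl v => {(v : V)}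
  | Sum.inr (Sum.inl e) => {v | v = G.tgt e ∧ b < φ.height v}
  | Sum.inr (Sum.inr e) => {v | v = G.src e ∧ φ.height v < a}

/-- No edge joins two inner vertices, as these have equal heights. So `stripCentre` is constant
along edges (empty for an edge crossing the whole strip), hence on connected components, and it
determines an inner vertex. -/
theorem isElementary_of_height_eq (hφ : φ.IsUpward)
    (h : ∀ u v, b < φ.height u → φ.height u < a → b < φ.height v → φ.height v < a →
      φ.height u = φ.height v) : (φ.stripGraph a b).IsElementary := by
  have hedge : ∀ e, φ.stripCentre a b ((φ.stripGraph a b).src e) =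
      φ.stripCentre a b ((φ.stripGraph a b).tgt e) := by
    intro e
    rcases lt_or_ge (φ.height (G.src e)) a with hs | hs <;>
      rcases lt_or_ge b (φ.height (G.tgt e)) with ht | ht
    · exact absurd (h _ _ e.2.2 hs ht e.2.1) (hφ.height_tgt_lt e).ne'
    · rw [stripGraph_src_of_lt hs, stripGraph_tgt_of_le ht]
      ext v
      simp only [stripCentre, mem_singleton_iff, mem_ofPred_eq]
      exact ⟨fun h => ⟨h, h ▸ hs⟩, And.left⟩
    · rw [stripGraph_src_of_le hs, stripGraph_tgt_of_lt ht]
      ext v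
      simp only [stripCentre, mem_singleton_iff, mem_ofPred_eq]
      exact ⟨And.left, fun h => ⟨h, h ▸ ht⟩⟩
    · rw [stripGraph_src_of_le hs, stripGraph_tgt_of_le ht]
      ext v
      simp only [stripCentre, mem_ofPred_eq]
      exact ⟨fun h => absurd (h.1 ▸ h.2) ht.not_gt, fun h => absurd (h.1 ▸ h.2) hs.not_gt⟩
  have hconn : ∀ u v, (φ.stripGraph a b).Connected u v →
      φ.stripCentre a b u = φ.stripCentre a b v := by
    intro u v huv
    induction huv with
    | rel u v h =>
      obtain ⟨e, rfl, rfl⟩ := h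
      exact hedge e
    | refl => rfl
    | symm _ _ _ ih => exact ih.symm
    | trans _ _ _ _ _ ih ih' => exact ih.trans ih'
  rintro (u | x) (v | x') hu hv huv
  · exact congrArg Sum.inl (Subtype.ext (singleton_injective (hconn _ _ huv)))
  · exact absurd (stripGraph_degree_inr x') hv
  · exact absurd (stripGraph_degree_inr x) hu
  · exact absurd (stripGraph_degree_inr x') hv

/-- Induction removing the largest height `m`: a line `c` just below `m` isolates it, and the
remaining heights are separated between `b` and `c`. -/
theorem exists_separating_heights (H : Finset ℝ) (a b : ℝ) (hab : b < a)
    (hH : ∀ x ∈ H, b < x ∧ x < a) :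
    ∃ (n : ℕ) (y : ℕ → ℝ), y 0 = a ∧ y (n + 1) = b ∧ (∀ k ≤ n, y (k + 1) < y k) ∧
      (∀ k < n, y (k + 1) ∉ H) ∧
      ∀ k ≤ n, ∀ x ∈ H, ∀ x' ∈ H, y (k + 1) < x → x < y k → y (k + 1) < x' → x' < y k →
        x = x' := by
  induction H using Finset.induction_on_max generalizing a with
  | empty =>
    exact ⟨0, fun k => if k = 0 then a else b, by simp, by simp, by simpa using hab, by simp,
      by simp⟩
  | insert m H hm ih =>
    obtain ⟨hbm, hma⟩ := hH m (Finset.mem_insert_self _ _)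
    obtain ⟨c, hbc, hcm, hcH⟩ : ∃ c, b < c ∧ c < m ∧ ∀ x ∈ H, x < c := by
      -- Inserting `b` makes the set nonempty and at the same time gives `b < c`.
      have hlt : (insert b H).max' (Finset.insert_nonempty _ _) < m :=
        (Finset.max'_lt_iff _ _).2 (Finset.forall_mem_insert _ _ _ |>.2 ⟨hbm, hm⟩)
      obtain ⟨c, h1, h2⟩ := exists_between hlt
      rw [Finset.max'_lt_iff] at h1
      exact ⟨c, h1 _ (Finset.mem_insert_self _ _), h2,
        fun x hx => h1 x (Finset.mem_insert_of_mem hx)⟩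
    obtain ⟨n, y, h0, h1, hdec, hav, hsep⟩ := ih c hbc fun x hx =>
      ⟨(hH x (Finset.mem_insert_of_mem hx)).1, hcH x hx⟩
    have hle : ∀ k ≤ n + 1, y k ≤ c := by
      intro k
      induction k with
      | zero => exact fun _ => h0.le
      | succ k ih => exact fun hk => (hdec k (by omega)).le.trans (ih (by omega))
    refine ⟨n + 1, fun k => k.casesOn a y, rfl, h1, ?_, ?_, ?_⟩
    · rintro (_ | k) hk
      · exact h0.trans_lt (hcm.trans hma)
      · exact hdec k (by omega)
    · rintro (_ | k) hk hmem
      · simp only [h0, Finset.mem_insert] at hmem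
        exact hmem.elim hcm.ne fun h => (hcH c h).false
      · rcases Finset.mem_insert.1 hmem with h | h
        · exact ((hle (k + 1) (by omega)).trans_lt hcm).ne h
        · exact hav k (by omega) h
    · rintro (_ | k) hk x hx x' hx' h1 h2 h3 h4
      · have hx1 : ∀ z ∈ insert m H, y 0 < z → z = m := fun z hz hlt =>
          (Finset.mem_insert.1 hz).resolve_right fun h => (h0 ▸ hlt).not_gt (hcH z h)
        rw [hx1 x hx h1, hx1 x' hx' h3]
      · have hx1 : ∀ z ∈ insert m H, z < y k → z ∈ H := fun z hz hlt =>
          (Finset.mem_insert.1 hz).resolve_left fun h =>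
            (h ▸ hlt.trans_le (hle k (by omega))).not_gt hcm
        exact hsep k (by omega) x (hx1 x hx h2) x' (hx1 x' hx' h4) h1 h2 h3 h4

theorem exists_isElementaryCut [Finite V] (hφ : φ.IsUpward) : ∃ n y, φ.IsElementaryCut n y := by
  -- Only heights strictly inside the box are separated. The intermediate lines lie there too, so
  -- avoiding these heights avoids all vertices.
  have hfin : (range φ.height ∩ Ioo φ.bottom φ.top).Finite := (finite_range _).inter_of_left _
  obtain ⟨n, y, h0, h1, hdec, hav, hsep⟩ := exists_separating_heights hfin.toFinset φ.top φ.bottom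
    φ.bottom_lt_top (by simp)
  have hle : ∀ k ≤ n + 1, y k ≤ φ.top := by
    intro k
    induction k with
    | zero => exact fun _ => h0.le
    | succ k ih => exact fun hk => (hdec k (by omega)).le.trans (ih (by omega))
  have hge : ∀ k ≤ n + 1, φ.bottom ≤ y k := by
    intro k hk
    induction hk using Nat.decreasingInduction with
    | self => exact h1.ge
    | of_succ k hk ih => exact ih.trans (hdec k (by omega)).le
  refine ⟨n, y, h0, h1, hdec, fun k hk v hv => hav k hk ?_, fun k hk => ?_⟩
  · simp only [Finite.mem_toFinset]
    exact ⟨⟨v, hv⟩, (hge (k + 2) (by omega)).trans_lt (hdec _ hk),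
      (hdec k hk.le).trans_le (hle _ (by omega))⟩
  · refine isElementary_of_height_eq hφ fun u v hu hu' hv hv' =>
      hsep k hk _ ?_ _ ?_ hu hu' hv hv' <;> simp only [Finite.mem_toFinset]
    · exact ⟨⟨u, rfl⟩, (hge _ (by omega)).trans_lt hu, hu'.trans_le (hle _ (by omega))⟩
    · exact ⟨⟨v, rfl⟩, (hge _ (by omega)).trans_lt hv, hv'.trans_le (hle _ (by omega))⟩

end Cuts

end BPEmbedding

theorem proposition1p1 {V E : Type*} [Finite V] [Finite E] (G : DirectedMultigraph V E)
    (hG : G.IsProgressive) (φ : BPEmbedding G) (hφ : φ.IsUpward) :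
    (∃ (n : ℕ) (y : ℕ → ℝ), φ.IsElementaryCut n y) ∧
    (∀ (n : ℕ) (y : ℕ → ℝ), φ.IsElementaryCut n y →
      (∀ k ≤ n, (φ.stripGraph (y k) (y (k + 1))).IsProgressive ∧
        (φ.stripGraph (y k) (y (k + 1))).IsPlanarOrder (φ.LayerLT (y k) (y (k + 1)))) ∧
      (∀ k < n, φ.SeamMatches y k)) ∧
    ∃! r : E → E → Prop, G.IsPlanarOrder r ∧
      ∀ (n : ℕ) (y : ℕ → ℝ), φ.IsElementaryCut n y →
        (φ.composite y n).carrier = Set.univ ∧ (φ.composite y n).lt = r := by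
  have hcomp : ∀ (n : ℕ) (y : ℕ → ℝ), φ.IsElementaryCut n y →
      (φ.composite y n).carrier = Set.univ ∧
        (φ.composite y n).lt = BPEmbedding.EdgeLT hφ := fun n y hy => by
    rw [hy.composite_last hG hφ]
    refine ⟨rfl, ?_⟩
    funext e e'
    simp [OrderedEdges.restrict]
  refine ⟨BPEmbedding.exists_isElementaryCut hφ, fun n y hy => ⟨fun k hk =>
    ⟨(hy.isSlab hφ hk).isProgressive_stripGraph hφ, hy.isPlanarOrder_layerLT hG hφ hk⟩,
    fun k hk => hy.seamMatches hG hφ hk⟩, BPEmbedding.EdgeLT hφ,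
    ⟨BPEmbedding.isPlanarOrder_edgeLT hφ, hcomp⟩, ?_⟩
  rintro r ⟨-, hr⟩
  -- Without a cut the condition on `r` would be vacuous; one cut already determines `r`.
  obtain ⟨n, y, hy⟩ := BPEmbedding.exists_isElementaryCut hφ
  rw [← (hr n y hy).2, (hcomp n y hy).2]
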